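/- Let $K$ be a number field with ring of integers $\mathcal{O}_K$, let $\mathfrak{p}$ be a finite prime of $K$ (dyadic or not) with completion $K_\mathfrak{p}$, and let $\varphi$ be a non-degenerate quadratic form of dimension $n$ over $K$. Write $\det\varphi$ for the determinant of a Gram matrix of $\varphi$ (with respect to any basis), $\operatorname{disc}\varphi=(-1)^{n(n-1)/2}\det\varphi$, and $\varphi_\mathfrak{p}=\varphi\otimes K_\mathfrak{p}$. A form is hyperbolic if it is isometric to $m\langle 1,-1\rangle$ for some $m\ge 0$; the anisotropic part of $\varphi_\mathfrak{p}$ is the anisotropic form $\psi$ with $\varphi_\mathfrak{p}\cong\psi\perp H$, $H$ hyperbolic (it exists, and its dimension $d_\mathfrak{p}$ is uniquely determined). Then: 1. If $n$ is even, then $d_\mathfrak{p}=0$ if $\varphi_\mathfrak{p}$ is hyperbolic; $d_\mathfrak{p}=4$ if $\varphi_\mathfrak{p}$ is not hyperbolic and $\operatorname{disc}\varphi$ is a square in $K_\mathfrak{p}$; and $d_\mathfrak{p}=2$ if $\varphi_\mathfrak{p}$ is not hyperbolic and $\operatorname{disc}\varphi$ is not a square in $K_\mathfrak{p}$. 2.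 If $n$ is odd, put $\psi=\varphi\perp\langle(-1)^{n(n+1)/2}\det\varphi\rangle$. Then $d_\mathfrak{p}=1$ if $\psi\otimes K_\mathfrak{p}$ is hyperbolic, and $d_\mathfrak{p}=3$ otherwise. Consequently, if $\varphi$ is presented as $\langle a_1,\dots,a_n\rangle$ with $a_i\in\mathcal{O}_K$, the following procedure returns the dimension of the anisotropic part of $\varphi_\mathfrak{p}$. For $n$ even: return $0$ if $\varphi_\mathfrak{p}$ is hyperbolic; otherwise return $4$ if $(-1)^{n(n-1)/2}a_1\cdots a_n$ is a square in $K_\mathfrak{p}$, and $2$ if it is not. For $n$ odd: return $1$ if $\langle a_1,\dots,a_n,(-1)^{n(n+1)/2}a_1\cdots a_n\rangle\otimes K_\mathfrak{p}$ is hyperbolic, and $3$ otherwise. -/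

import Mathlib

open IsDedekindDomain NumberField

noncomputable section

/-- The hyperbolic space `m⟨1, -1⟩`: the orthogonal sum of `m` copies of the binary form
`⟨1, -1⟩` (the zero-dimensional form when `m = 0`). -/
def hyperbolicSpace (F : Type*) [Field F] (m : ℕ) : QuadraticForm F (Fin m → Fin 2 → F) :=
  QuadraticMap.pi fun _ => QuadraticMap.weightedSumSquares F ![(1 : F), -1]

/-- A quadratic form is hyperbolic if it is isometric to `m⟨1, -1⟩` for some `m`. -/
def IsHyperbolic {F V : Type*} [Field F] [AddCommGroup V] [Module F V]
    (Q : QuadraticForm F V) : Prop :=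
  ∃ m : ℕ, Q.Equivalent (hyperbolicSpace F m)

/-- `ψ` is an anisotropic part of `Q`: `ψ` is anisotropic, and `Q ≅ ψ ⊥ H` with `H` hyperbolic. -/
def IsAnisotropicPart {F V W : Type*} [Field F] [AddCommGroup V] [Module F V]
    [AddCommGroup W] [Module F W] (Q : QuadraticForm F V) (ψ : QuadraticForm F W) : Prop :=
  ψ.Anisotropic ∧ ∃ m : ℕ, Q.Equivalent (ψ.prod (hyperbolicSpace F m))

/-- The anisotropic part of `Q` has dimension `d`: there is an anisotropic part of `Q` of
dimension `d`, and every anisotropic part of `Q` has dimension `d`. -/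
def AnisotropicPartHasDim {F V : Type*} [Field F] [AddCommGroup V] [Module F V]
    (Q : QuadraticForm F V) (d : ℕ) : Prop :=
  (∃ ψ : QuadraticForm F (Fin d → F), IsAnisotropicPart Q ψ) ∧
    ∀ (e : ℕ) (ψ : QuadraticForm F (Fin e → F)), IsAnisotropicPart Q ψ → e = d

/-- The unary form `⟨c⟩`, that is `x ↦ c x²`. -/
def unaryForm {F : Type*} [Field F] (c : F) : QuadraticForm F F :=
  c • QuadraticMap.sq

variable {K : Type*} [Field K] [NumberField K]

/-- The localization `φ ⊗ K_𝔭` of a form `φ` over `K` at a finite prime `𝔭`. -/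
def localForm (𝔭 : HeightOneSpectrum (𝓞 K)) {V : Type*} [AddCommGroup V]
    [Module K V] (φ : QuadraticForm K V) :
    QuadraticForm (𝔭.adicCompletion K) (TensorProduct K (𝔭.adicCompletion K) V) :=
  φ.baseChange (𝔭.adicCompletion K)

/-- `c` is a square in `K_𝔭`. -/
def IsLocalSquare (𝔭 : HeightOneSpectrum (𝓞 K)) (c : K) : Prop :=
  IsSquare (algebraMap K (𝔭.adicCompletion K) c)

/-- The form `⟨a₁, …, aₙ⟩` over `K` given by a list of entries from `𝓞 K`. -/
def diagForm (a : List (𝓞 K)) : QuadraticForm K (Fin a.length → K) :=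
  QuadraticMap.weightedSumSquares K fun i => algebraMap (𝓞 K) K (a.get i)

open Classical in
/-- The number returned by the algorithm for the input form `φ = ⟨a₁, …, aₙ⟩` and the finite
prime `𝔭`. The tests made on the way are "is this form hyperbolic over `K_𝔭`?" and
"is this element a square in `K_𝔭`?"; here `a.prod = det φ`. -/
def anisotropicPartLocalDim (𝔭 : HeightOneSpectrum (𝓞 K))
    (a : List (𝓞 K)) : ℕ :=
  let n := a.length
  if Even n then
    if IsHyperbolic (localForm 𝔭 (diagForm a)) then 0
    else if IsLocalSquare 𝔭 (algebraMap (𝓞 K) K ((-1) ^ (n * (n - 1) / 2) * a.prod)) then 4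
    else 2
  else
    if IsHyperbolic (localForm 𝔭 (diagForm (a ++ [(-1) ^ (n * (n + 1) / 2) * a.prod]))) then 1
    else 3

end

/-!
Write `F` for the completion of `K` at the prime, `O` for its ring of integers, `ϖ` for a
uniformizer. The dimension of the anisotropic part is determined by its parity, its discriminant and
the hyperbolicity of the form once two facts about anisotropic forms `q` over `F` are known:

* `q` has dimension at most four (`card_le_four_of_anisotropic`);
* in dimension four the determinant of `q` is a square
  (`isSquare_det_polarGram_of_anisotropic`).

Both are proved uniformly in the residue characteristic, without Hilbert symbols. By Hensel's lemma
an anisotropic form satisfies a Cauchy–Schwarz inequality for valuations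
(`polar_eq_zero_of_mul_eq`), so the vectors with `q x ∈ O` form a lattice `M`, those with
`q x ∈ ϖ O` a sublattice `M₁`, and `q` and `ϖ⁻¹ q` induce anisotropic quadratic forms over the finite
residue field on `M / M₁` and `M₁ / ϖ M`. By the theorem of Chevalley and Warning these have
dimension at most two, hence `dim q ≤ 4`. In dimension four both are anisotropic binary forms over
a finite field; the product of their discriminants is again a discriminant, of a quadratic
polynomial with a simple root (`IsAnisotropicBinary.exists_simple_root`), and Hensel's lemma lifts
this root to a square root of the determinant of `q`. Instead of quotients of lattices, the proof
uses a basis that is extremal for the valuation of the Gram determinant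
(`exists_extremal_family`).

Existence of an anisotropic part follows by splitting off hyperbolic planes
(`exists_isAnisotropicPart`). What is needed of its uniqueness follows from a bound on the dimension
of totally isotropic subspaces (`finrank_le_of_isAnisotropic`), without Witt's cancellation theorem.
The discriminant of the form is that of its anisotropic part up to squares and a sign
(`discr_eq_of_equivalent_prod_hyperbolicSpace`). Finally, the completion of `K` at the prime is the
fraction field of a Henselian discrete valuation ring with finite residue field.
-/

/-! ### Binary and ternary quadratic forms over a finite field -/

/-- The binary form `a x² + b x y + d y²` has only the trivial zero. -/
def IsAnisotropicBinary {k : Type*} [Field k] (a b d : k) : Prop :=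
  ∀ x y : k, a * x ^ 2 + b * (x * y) + d * y ^ 2 = 0 → x = 0 ∧ y = 0

theorem IsAnisotropicBinary.left_ne_zero {k : Type*} [Field k] {a b d : k}
    (h : IsAnisotropicBinary a b d) : a ≠ 0 := by
  rintro rfl
  simpa using h 1 0 (by simp)

section FiniteField
variable {k : Type*} [Field k] [Finite k]

/-- A ternary quadratic form over a finite field has a non-trivial zero. -/
theorem exists_ternary_zero (A B C D E G : k) :
    ∃ a : Fin 3 → k, a ≠ 0 ∧ A * a 0 ^ 2 + B * a 1 ^ 2 + C * a 2 ^ 2 +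
      D * (a 0 * a 1) + E * (a 0 * a 2) + G * (a 1 * a 2) = 0 := by
  classical
  have := Fintype.ofFinite k
  obtain ⟨p, hp⟩ := CharP.exists k
  have hprime : p.Prime := (CharP.char_is_prime_or_zero k p).resolve_right
    (CharP.char_ne_zero_of_finite k p)
  let X : Fin 3 → MvPolynomial (Fin 3) k := MvPolynomial.X
  let f : MvPolynomial (Fin 3) k :=
    MvPolynomial.C A * (X 0 * X 0) + MvPolynomial.C B * (X 1 * X 1) +
      MvPolynomial.C C * (X 2 * X 2) + MvPolynomial.C D * (X 0 * X 1) +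
      MvPolynomial.C E * (X 0 * X 2) + MvPolynomial.C G * (X 1 * X 2)
  have hmon : ∀ (c : k) (i j : Fin 3), (MvPolynomial.C c * (X i * X j)).totalDegree ≤ 2 := by
    intro c i j
    refine (MvPolynomial.totalDegree_mul _ _).trans ?_
    rw [MvPolynomial.totalDegree_C, zero_add]
    refine (MvPolynomial.totalDegree_mul _ _).trans ?_
    simp [X, MvPolynomial.totalDegree_X]
  have hf : f.totalDegree < Fintype.card (Fin 3) := by
    have : f.totalDegree ≤ 2 := by
      refine (MvPolynomial.totalDegree_add _ _).trans (max_le ?_ (hmon _ _ _))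
      refine (MvPolynomial.totalDegree_add _ _).trans (max_le ?_ (hmon _ _ _))
      refine (MvPolynomial.totalDegree_add _ _).trans (max_le ?_ (hmon _ _ _))
      refine (MvPolynomial.totalDegree_add _ _).trans (max_le ?_ (hmon _ _ _))
      exact (MvPolynomial.totalDegree_add _ _).trans (max_le (hmon _ _ _) (hmon _ _ _))
    simpa using Nat.lt_succ_of_le this
  have hdvd := char_dvd_card_solutions p hf
  have hpos : 0 < Fintype.card {x : Fin 3 → k // MvPolynomial.eval x f = 0} :=
    Fintype.card_pos_iff.2 ⟨⟨0, by simp [f, X]⟩⟩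
  have hone : 1 < Fintype.card {x : Fin 3 → k // MvPolynomial.eval x f = 0} :=
    hprime.one_lt.trans_le (Nat.le_of_dvd hpos hdvd)
  obtain ⟨⟨a, ha⟩, hne⟩ := Fintype.exists_ne_of_one_lt_card hone ⟨0, by simp [f, X]⟩
  refine ⟨a, fun h => hne (Subtype.ext h), ?_⟩
  simp only [f, X, map_add, map_mul, MvPolynomial.eval_C, MvPolynomial.eval_X] at ha
  linear_combination ha

/-- Over a finite field, which is perfect, an anisotropic binary form has non-zero discriminant,
in characteristic two as well. -/
theorem IsAnisotropicBinary.discrim_ne_zero {a b d : k} (h : IsAnisotropicBinary a b d) :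
    b ^ 2 - 4 * a * d ≠ 0 := by
  intro h0
  have ha := h.left_ne_zero
  by_cases h2 : (2 : k) = 0
  · have hb : b = 0 := by
      have : b ^ 2 = 0 := by linear_combination h0 + 2 * a * d * h2
      simpa using this
    subst hb
    have hchar : ringChar k = 2 := by
      have := ringChar.dvd (R := k) (x := 2) (by exact_mod_cast h2)
      rcases (Nat.dvd_prime Nat.prime_two).1 this with h1 | h1
      · exact absurd h1 (CharP.ringChar_ne_one)
      · exact h1
    obtain ⟨s, hs⟩ := FiniteField.isSquare_of_char_two hchar (d / a)
    have := (h s 1 (by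
      have : d = a * (s * s) := by rw [← hs]; field_simp
      rw [this]
      linear_combination (a * s ^ 2) * h2)).2
    exact one_ne_zero this
  · have := (h b (-(2 * a)) (by linear_combination -a * h0)).2
    simp [ha, h2] at this

/-- The product of two discriminants of anisotropic binary forms over a finite field is again the
discriminant of a quadratic polynomial, and this one has a simple root. In odd characteristic this
says that a product of two non-squares is a square; in characteristic two, that the image of the
Artin–Schreier map `z ↦ z² + z` has index two. -/
theorem IsAnisotropicBinary.exists_simple_root {a b d e f g : k}
    (h₁ : IsAnisotropicBinary a b d) (h₂ : IsAnisotropicBinary e f g) :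
    ∃ t : k, t ^ 2 - b * f * t + (b ^ 2 * (e * g) + f ^ 2 * (a * d) - 4 * (a * d) * (e * g)) = 0 ∧
      2 * t - b * f ≠ 0 := by
  classical
  have := Fintype.ofFinite k
  have hD1 := h₁.discrim_ne_zero
  have hD2 := h₂.discrim_ne_zero
  have ha := h₁.left_ne_zero
  have he := h₂.left_ne_zero
  suffices ∃ t : k, t ^ 2 - b * f * t +
      (b ^ 2 * (e * g) + f ^ 2 * (a * d) - 4 * (a * d) * (e * g)) = 0 by
    obtain ⟨t, ht⟩ := this
    refine ⟨t, ht, fun h0 => mul_ne_zero hD1 hD2 ?_⟩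
    linear_combination (2 * t - b * f) * h0 - 4 * ht
  by_cases h2 : (2 : k) = 0
  · have hb : b ≠ 0 := by
      rintro rfl
      exact hD1 (by linear_combination -2 * a * d * h2)
    have hf : f ≠ 0 := by
      rintro rfl
      exact hD2 (by linear_combination -2 * e * g * h2)
    let AS : k →+ k :=
      { toFun := fun z => z ^ 2 + z
        map_zero' := by simp
        map_add' := fun x y => by linear_combination (x * y) * h2 }
    have hker : Nat.card AS.ker = 2 := by
      have : (AS.ker : Set k) = {0, 1} := by
        ext z
        simp only [SetLike.mem_coe, AddMonoidHom.mem_ker, Set.mem_insert_iff,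
          Set.mem_singleton_iff]
        change z ^ 2 + z = 0 ↔ _
        constructor
        · intro hz
          have : z * (z - 1) = 0 := by linear_combination hz - z * h2
          rcases mul_eq_zero.1 this with h | h
          · exact Or.inl h
          · exact Or.inr (sub_eq_zero.1 h)
        · rintro (rfl | rfl)
          · simp
          · linear_combination h2
      rw [← SetLike.coe_sort_coe, this, Nat.card_coe_set_eq, Set.ncard_pair zero_ne_one]
    have hindex : AS.range.index = 2 := by
      have h1 := AddSubgroup.card_mul_index AS.ker
      have h3 := AddSubgroup.card_mul_index AS.range
      rw [AddSubgroup.index_ker, hker] at h1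
      have hpos : 0 < Nat.card AS.range := Nat.card_pos
      have : Nat.card AS.range * AS.range.index = Nat.card AS.range * 2 := by
        rw [h3, ← h1, mul_comm]
      exact Nat.eq_of_mul_eq_mul_left hpos this
    have hnot : ∀ {a b d : k}, IsAnisotropicBinary a b d → b ≠ 0 → a ≠ 0 →
        a * d / b ^ 2 ∉ AS.range := by
      rintro a b d h hb ha ⟨z, hz⟩
      change z ^ 2 + z = _ at hz
      have hz' : b ^ 2 * (z ^ 2 + z) = a * d := by rw [hz]; field_simp
      have := (h (b * z / a) 1 (by
        field_simp
        linear_combination hz' + a * d * h2)).2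
      exact one_ne_zero this
    have hmem : a * d / b ^ 2 + e * g / f ^ 2 ∈ AS.range := by
      rw [AddSubgroup.add_mem_iff_of_index_two hindex]
      exact iff_of_false (hnot h₁ hb ha) (hnot h₂ hf he)
    obtain ⟨z, hz⟩ := hmem
    change z ^ 2 + z = _ at hz
    have hz' : (b * f) ^ 2 * (z ^ 2 + z) = f ^ 2 * (a * d) + b ^ 2 * (e * g) := by
      rw [hz]; field_simp
    refine ⟨b * f * z, ?_⟩
    linear_combination hz' + (f ^ 2 * (a * d) + b ^ 2 * (e * g) - 2 * (a * d) * (e * g)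
      - (b * f) ^ 2 * z) * h2
  · have hns : ∀ {a b d : k}, IsAnisotropicBinary a b d → a ≠ 0 →
        ¬ IsSquare (b ^ 2 - 4 * a * d) := by
      rintro a b d h ha ⟨s, hs⟩
      have := (h (s - b) (2 * a) (by linear_combination -a * hs)).2
      simp [ha, h2] at this
    have hchar : ringChar k ≠ 2 := by
      intro h
      apply h2
      have := ringChar.spec k 2
      exact_mod_cast this.2 (by rw [h])
    have hsq : IsSquare ((b ^ 2 - 4 * a * d) * (f ^ 2 - 4 * e * g)) := by
      rw [← quadraticChar_one_iff_isSquare (mul_ne_zero hD1 hD2), map_mul,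
        quadraticChar_neg_one_iff_not_isSquare.2 (hns h₁ ha),
        quadraticChar_neg_one_iff_not_isSquare.2 (hns h₂ he)]
      norm_num
    obtain ⟨s, hs⟩ := hsq
    refine ⟨(b * f + s) / 2, ?_⟩
    field_simp
    linear_combination -hs

end FiniteField

/-! ### Anisotropic forms over the fraction field of a Henselian discrete valuation ring -/

section Henselian

open IsLocalRing QuadraticMap

/-- Hensel's lemma for monic quadratic polynomials. -/
theorem exists_quadratic_root {O : Type*} [CommRing O] [HenselianLocalRing O] {b c t : O}
    (ht : t ^ 2 - b * t + c ∈ maximalIdeal O) (hu : IsUnit (2 * t - b)) :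
    ∃ s : O, s ^ 2 - b * s + c = 0 ∧ s - t ∈ maximalIdeal O := by
  classical
  have hm : (Polynomial.X ^ 2 - Polynomial.C b * Polynomial.X + Polynomial.C c :
      Polynomial O).Monic := by monicity!
  obtain ⟨s, hs, hst⟩ := HenselianLocalRing.is_henselian _ hm t (by simpa using ht) (by
    convert! hu using 1
    simp [one_add_one_eq_two])
  exact ⟨s, by simpa [Polynomial.IsRoot] using hs, hst⟩

variable {O F V : Type*} [CommRing O] [IsDomain O] [IsDiscreteValuationRing O]
  [HenselianLocalRing O] [Field F] [Algebra O F] [IsFractionRing O F]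
  [AddCommGroup V] [Module F V]

omit [IsDomain O] [IsDiscreteValuationRing O] [IsFractionRing O F] in
/-- A Cauchy–Schwarz inequality for anisotropic forms: `v(q x) + v(q y) ≤ 2 v(b(x, y))`. Otherwise,
by Hensel's lemma, the quadratic polynomial `q (X x + y)` would have a root. -/
theorem polar_eq_zero_of_mul_eq {q : QuadraticForm F V} (hq : q.Anisotropic) {x y : V} {c : O}
    (hc : c ∈ maximalIdeal O) (h : q x * q y = algebraMap O F c * polar q x y ^ 2) :
    polar q x y = 0 := by
  by_contra hb
  obtain ⟨u, hu, hu0⟩ := exists_quadratic_root (O := O) (b := -1) (c := c) (t := 0)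
    (by simpa using hc) (by simp)
  rw [sub_zero] at hu0
  have hu' : (algebraMap O F u) ^ 2 + algebraMap O F u + algebraMap O F c = 0 := by
    rw [← map_pow, ← map_add, ← map_add, ← map_zero (algebraMap O F)]
    congr 1
    linear_combination hu
  have h1 : q ((polar q x y * algebraMap O F u) • x + q x • y) = 0 := by
    rw [QuadraticMap.map_add q, QuadraticMap.map_smul, QuadraticMap.map_smul, polar_smul_left,
      polar_smul_right]
    simp only [smul_eq_mul]
    linear_combination q x * polar q x y ^ 2 * hu' + q x * h
  have h2 := hq _ h1
  have h3 : polar q ((polar q x y * algebraMap O F u) • x + q x • y) x = 0 := by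
    rw [h2, polar_zero_left]
  rw [polar_add_left, polar_smul_left, polar_smul_left, polar_self, polar_comm q y x] at h3
  simp only [smul_eq_mul] at h3
  have hx : q x ≠ 0 := by
    intro h0
    apply hb
    rw [hq x h0, polar_zero_left]
  have h4 : polar q x y * q x * algebraMap O F (2 * u + 1) = 0 := by
    rw [map_add, map_mul, map_one, map_ofNat]
    linear_combination h3
  have hunit : IsUnit (2 * u + 1) := by
    by_contra hn
    have hmem : 2 * u + 1 ∈ maximalIdeal O := hn
    have : (1 : O) ∈ maximalIdeal O := by
      have := Ideal.sub_mem _ hmem (Ideal.mul_mem_left _ 2 hu0)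
      simp at this
    exact (Ideal.ne_top_iff_one _).1 (maximalIdeal.isMaximal O).ne_top this
  exact mul_ne_zero (mul_ne_zero hb hx) (hunit.map (algebraMap O F)).ne_zero h4

variable (O) in
theorem exists_integer_or_inv_mem (z : F) :
    (∃ a : O, algebraMap O F a = z) ∨
      (z ≠ 0 ∧ ∃ β ∈ maximalIdeal O, algebraMap O F β = z⁻¹) := by
  rcases ValuationRing.isInteger_or_isInteger O z with ⟨a, ha⟩ | ⟨β, hβ⟩
  · exact Or.inl ⟨a, ha⟩
  · by_cases hu : IsUnit β
    · left
      obtain ⟨u, rfl⟩ := hu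
      refine ⟨(u⁻¹ : Oˣ), ?_⟩
      rw [← inv_inv z, ← hβ, eq_comm]
      apply inv_eq_of_mul_eq_one_right
      rw [← map_mul, Units.mul_inv, map_one]
    · by_cases hz : z = 0
      · exact Or.inl ⟨0, by simp [hz]⟩
      · exact Or.inr ⟨hz, β, hu, hβ⟩

theorem exists_polar_eq {q : QuadraticForm F V} (hq : q.Anisotropic) {x y : V} {a d : O}
    (hx : q x = algebraMap O F a) (hy : q y = algebraMap O F d) :
    ∃ b : O, polar q x y = algebraMap O F b := by
  rcases exists_integer_or_inv_mem O (polar q x y) with ⟨b, hb⟩ | ⟨h0, β, hβ, hb⟩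
  · exact ⟨b, hb.symm⟩
  · refine absurd (polar_eq_zero_of_mul_eq hq (c := a * d * β ^ 2) ?_ ?_) h0
    · exact Ideal.mul_mem_left _ _ (Ideal.pow_mem_of_mem _ hβ 2 two_pos)
    · rw [hx, hy]
      simp only [map_mul, map_pow, hb]
      field_simp

theorem exists_polar_eq_mem {q : QuadraticForm F V} (hq : q.Anisotropic) {x y : V} {a d : O}
    (hx : q x = algebraMap O F a) (hy : q y = algebraMap O F d) (ha : a ∈ maximalIdeal O) :
    ∃ b ∈ maximalIdeal O, polar q x y = algebraMap O F b := by
  obtain ⟨b, hb⟩ := exists_polar_eq hq hx hy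
  refine ⟨b, ?_, hb⟩
  by_contra hn
  have hu : IsUnit b := not_not.1 hn
  obtain ⟨u, rfl⟩ := hu
  have hb0 : polar q x y ≠ 0 := by
    rw [hb]; exact (u.isUnit.map (algebraMap O F)).ne_zero
  refine hb0 (polar_eq_zero_of_mul_eq hq (c := a * d * (u⁻¹ : Oˣ) ^ 2) ?_ ?_)
  · exact Ideal.mul_mem_right _ _ (Ideal.mul_mem_right _ _ ha)
  · rw [hx, hy, hb, ← map_mul, ← map_pow, ← map_mul]
    congr 1
    have : (u : O) * (u⁻¹ : Oˣ) = 1 := u.mul_inv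
    linear_combination -(a * d) * ((u : O) * (u⁻¹ : Oˣ) + 1) * this

/-- Three vectors on which an anisotropic form takes integral values have a primitive integral
combination at which its value is divisible by the uniformizer. -/
theorem exists_primitive_combination [Finite (ResidueField O)] {q : QuadraticForm F V}
    (hq : q.Anisotropic) {y : Fin 3 → V} (hy : ∀ i, ∃ a : O, q (y i) = algebraMap O F a) :
    ∃ a : Fin 3 → O, (∃ j, IsUnit (a j)) ∧ ∃ c ∈ maximalIdeal O,
      q (∑ i, algebraMap O F (a i) • y i) = algebraMap O F c := by
  choose A hA using hy
  obtain ⟨D, hD⟩ := exists_polar_eq hq (hA 0) (hA 1)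
  obtain ⟨E, hE⟩ := exists_polar_eq hq (hA 0) (hA 2)
  obtain ⟨G, hG⟩ := exists_polar_eq hq (hA 1) (hA 2)
  obtain ⟨t, ht0, ht⟩ := exists_ternary_zero (residue O (A 0)) (residue O (A 1)) (residue O (A 2))
    (residue O D) (residue O E) (residue O G)
  choose a ha using fun i => residue_surjective (R := O) (t i)
  refine ⟨a, ?_, A 0 * a 0 ^ 2 + A 1 * a 1 ^ 2 + A 2 * a 2 ^ 2 +
      D * (a 0 * a 1) + E * (a 0 * a 2) + G * (a 1 * a 2), ?_, ?_⟩
  · by_contra! hn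
    apply ht0
    ext i
    rw [← ha i, Pi.zero_apply, residue_eq_zero_iff]
    exact hn i
  · rw [← residue_eq_zero_iff]
    simp only [map_add, map_mul, map_pow, ha]
    exact ht
  · rw [Fin.sum_univ_three]
    simp only [QuadraticMap.map_add q, QuadraticMap.map_smul, polar_add_left, polar_smul_left,
      polar_smul_right, hA, hD, hE, hG, map_add, map_mul, map_pow, smul_eq_mul]
    ring

end Henselian

/-! ### Gram matrices -/

section Gram
open QuadraticMap

variable {F V ι : Type*} [Field F] [AddCommGroup V] [Module F V]

/-- The Gram matrix of a family of vectors with respect to the polar form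
`(x, y) ↦ q (x + y) - q x - q y`, which is defined over any ring over which `q` is. -/
def polarGram (q : QuadraticForm F V) (x : ι → V) : Matrix ι ι F :=
  Matrix.of fun i j => polar q (x i) (x j)

theorem polarGram_linearCombination [Fintype ι] {κ : Type*} (q : QuadraticForm F V) (x : ι → V)
    (P : Matrix κ ι F) :
    polarGram q (fun i => ∑ j, P i j • x j) = P * polarGram q x * P.transpose := by
  ext i j
  simp only [polarGram, Matrix.of_apply, Matrix.mul_apply, Matrix.transpose_apply]
  rw [← polarBilin_apply_apply, map_sum]
  simp only [map_sum, map_smul, LinearMap.smul_apply, LinearMap.sum_apply, polarBilin_apply_apply,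
    smul_eq_mul, Finset.sum_mul, Finset.mul_sum]
  refine Finset.sum_congr rfl fun l _ => Finset.sum_congr rfl fun m _ => ?_
  ring

variable [Fintype ι] [DecidableEq ι]

theorem det_polarGram_linearCombination (q : QuadraticForm F V) (x : ι → V) (P : Matrix ι ι F) :
    (polarGram q fun i => ∑ j, P i j • x j).det = P.det ^ 2 * (polarGram q x).det := by
  rw [polarGram_linearCombination, Matrix.det_mul, Matrix.det_mul, Matrix.det_transpose]
  ring

theorem det_polarGram_update (q : QuadraticForm F V) (x : ι → V) (j : ι) (a : ι → F) :
    (polarGram q (Function.update x j (∑ i, a i • x i))).det =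
      a j ^ 2 * (polarGram q x).det := by
  have h : Function.update x j (∑ i, a i • x i) =
      fun i => ∑ l, ((1 : Matrix ι ι F).updateRow j a) i l • x l := by
    ext i
    by_cases hij : i = j
    · subst hij; simp
    · simp [hij, Matrix.one_apply]
  have hdet : ((1 : Matrix ι ι F).updateRow j a).det = a j := by
    have := Matrix.det_updateRow_sum (1 : Matrix ι ι F) j a
    rw [Matrix.det_one, smul_eq_mul, mul_one] at this
    rw [← this]
    congr 2
    ext i
    simp [Matrix.one_apply]
  rw [h, det_polarGram_linearCombination, hdet]

theorem det_polarGram_ne_zero {q : QuadraticForm F V} (hq : q.Anisotropic) (h2 : (2 : F) ≠ 0)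
    {x : ι → V} (hx : LinearIndependent F x) : (polarGram q x).det ≠ 0 := by
  intro h0
  obtain ⟨v, hv0, hv⟩ := Matrix.exists_vecMul_eq_zero_iff.2 h0
  apply hv0
  have h1 : ∀ j, polar q (∑ i, v i • x i) (x j) = 0 := by
    intro j
    have := congrFun hv j
    rw [← polarBilin_apply_apply, map_sum, LinearMap.sum_apply]
    simpa [Matrix.vecMul, dotProduct, polarGram] using this
  have h3 : polar q (∑ i, v i • x i) (∑ i, v i • x i) = 0 := by
    conv_lhs => rw [← polarBilin_apply_apply]; arg 2; rfl
    rw [map_sum]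
    refine Finset.sum_eq_zero fun j _ => ?_
    rw [map_smul, polarBilin_apply_apply, h1, smul_zero]
  rw [polar_self, two_smul, ← two_mul, mul_eq_zero] at h3
  have h4 := hq _ (h3.resolve_left h2)
  exact funext (Fintype.linearIndependent_iff.1 hx v h4)

end Gram

/-! ### Extremal integral bases -/

section Local

open IsLocalRing QuadraticMap

variable {O F V ι : Type*} [CommRing O] [IsDomain O] [IsDiscreteValuationRing O]
  [HenselianLocalRing O] [Field F] [Algebra O F] [IsFractionRing O F]
  [AddCommGroup V] [Module F V]

theorem exists_det_polarGram_eq [Fintype ι] [DecidableEq ι] {q : QuadraticForm F V}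
    (hq : q.Anisotropic) {x : ι → V} {A : ι → O} (hA : ∀ i, q (x i) = algebraMap O F (A i)) :
    ∃ d : O, (polarGram q x).det = algebraMap O F d := by
  choose B hB using fun i j => exists_polar_eq hq (hA i) (hA j)
  refine ⟨(Matrix.of B).det, ?_⟩
  rw [RingHom.map_det]
  congr 1
  ext i j
  simp [polarGram, hB]

omit [IsDiscreteValuationRing O] [HenselianLocalRing O] in
variable (O) in
theorem exists_integral_linearIndependent (q : QuadraticForm F V) {b : ι → V}
    (hb : LinearIndependent F b) :
    ∃ (x : ι → V) (A : ι → O), LinearIndependent F x ∧ ∀ i, q (x i) = algebraMap O F (A i) := by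
  have : ∀ i, ∃ (s : Fˣ) (A : O), q (s • b i) = algebraMap O F A := by
    intro i
    obtain ⟨n, s, hs, hns⟩ := IsFractionRing.div_surjective (A := O) (q (b i))
    have hs0 : algebraMap O F s ≠ 0 := IsFractionRing.to_map_ne_zero_of_mem_nonZeroDivisors hs
    refine ⟨Units.mk0 _ hs0, s * n, ?_⟩
    rw [Units.smul_mk0, QuadraticMap.map_smul, ← hns, smul_eq_mul, map_mul]
    field_simp
  choose s A hA using this
  exact ⟨fun i => s i • b i, A, hb.units_smul s, hA⟩

/-- A space with an anisotropic form over the fraction field of `O` has a basis `x` on which the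
form is integral and which is extremal in two ways: if a combination of the `x i` with integral
coefficients, the `j`-th one a unit, takes a value divisible by the uniformizer, then so does
`x j`; and no primitive combination takes a value divisible by the square of the uniformizer.

The basis minimizes first the valuation of its Gram determinant (so that it spans the lattice of
all vectors with integral values), then the number of `i` for which `q (x i)` is a unit. -/
theorem exists_extremal_family [Fintype ι] {q : QuadraticForm F V}
    (hq : q.Anisotropic) (h2 : (2 : F) ≠ 0) {b : ι → V} (hb : LinearIndependent F b) :
    ∃ (x : ι → V) (A : ι → O), (∀ i, q (x i) = algebraMap O F (A i)) ∧
      ∀ (a : ι → O) (j : ι) (c : O), IsUnit (a j) →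
        q (∑ i, algebraMap O F (a i) • x i) = algebraMap O F c →
        (c ∈ maximalIdeal O → A j ∈ maximalIdeal O) ∧ c ∉ maximalIdeal O ^ 2 := by
  classical
  obtain ⟨ϖ, hϖ⟩ := IsDiscreteValuationRing.exists_irreducible O
  let S : (ι → O) → Finset ι := fun A => {i | A i ∉ maximalIdeal O}
  let Φ : ℕ → Prop := fun N => ∃ (x : ι → V) (A : ι → O) (d : O) (k : ℕ),
    (∀ i, q (x i) = algebraMap O F (A i)) ∧ (polarGram q x).det = algebraMap O F d ∧
      Associated d (ϖ ^ k) ∧ N = (Fintype.card ι + 1) * k + (S A).card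
  have hex : ∃ N, Φ N := by
    obtain ⟨x, A, hx, hA⟩ := exists_integral_linearIndependent O q hb
    obtain ⟨d, hd⟩ := exists_det_polarGram_eq hq hA
    have hd0 : d ≠ 0 := by
      rintro rfl
      exact det_polarGram_ne_zero hq h2 hx (by rw [hd, map_zero])
    obtain ⟨k, hk⟩ := IsDiscreteValuationRing.associated_pow_irreducible hd0 hϖ
    exact ⟨_, x, A, d, k, hA, hd, hk, rfl⟩
  obtain ⟨x, A, d, k, hA, hd, hk, hN⟩ := Nat.find_spec hex
  refine ⟨x, A, hA, fun a j c ha hc => ⟨fun hcm => ?_, fun hcm => ?_⟩⟩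
  · by_contra hj
    -- replacing `x j` by the combination keeps the determinant and adds a non-unit value
    have hlt : (S (Function.update A j c)).card < (S A).card := by
      apply Finset.card_lt_card
      refine ⟨fun i hi => ?_, fun h => ?_⟩
      · by_cases hij : i = j
        · subst hij; simpa [S] using hj
        · simpa [S, hij] using hi
      · have := h (show j ∈ S A by simpa [S] using hj)
        simp [S] at this
        exact hcm this
    refine Nat.find_min hex (m := (Fintype.card ι + 1) * k + (S (Function.update A j c)).card)
      (by rw [hN]; omega) ⟨Function.update x j (∑ i, algebraMap O F (a i) • x i),
      Function.update A j c, a j ^ 2 * d, k, ?_, ?_, ?_, rfl⟩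
    · intro i
      by_cases hij : i = j
      · subst hij; simpa using hc
      · simpa [hij] using hA i
    · rw [det_polarGram_update, hd, map_mul, map_pow]
    · exact (associated_unit_mul_left _ _ (ha.pow 2)).trans hk
  · -- dividing the combination by the uniformizer would decrease the valuation of the determinant
    rw [hϖ.maximalIdeal_eq, Ideal.span_singleton_pow, Ideal.mem_span_singleton] at hcm
    obtain ⟨c', rfl⟩ := hcm
    have hϖ0 : algebraMap O F ϖ ≠ 0 := by
      simpa using hϖ.ne_zero
    have hy : q (∑ i, (algebraMap O F (a i) / algebraMap O F ϖ) • x i) = algebraMap O F c' := by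
      have : ∑ i, (algebraMap O F (a i) / algebraMap O F ϖ) • x i =
          (algebraMap O F ϖ)⁻¹ • ∑ i, algebraMap O F (a i) • x i := by
        rw [Finset.smul_sum]
        refine Finset.sum_congr rfl fun i _ => ?_
        rw [smul_smul, div_eq_inv_mul]
      rw [this, QuadraticMap.map_smul, hc, smul_eq_mul, map_mul, map_pow]
      field_simp
    set x' := Function.update x j (∑ i, (algebraMap O F (a i) / algebraMap O F ϖ) • x i) with hx'
    have hA' : ∀ i, q (x' i) = algebraMap O F (Function.update A j c' i) := by
      intro i
      by_cases hij : i = j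
      · subst hij; simpa [x'] using hy
      · simpa [x', hij] using hA i
    obtain ⟨d', hd'⟩ := exists_det_polarGram_eq hq hA'
    have hdd : ϖ ^ 2 * d' = a j ^ 2 * d := by
      apply IsFractionRing.injective O F
      rw [map_mul, ← hd', hx', det_polarGram_update, hd, map_mul, map_pow, map_pow]
      field_simp
    have hd0 : d' ≠ 0 := by
      rintro rfl
      have h0 : d = 0 := by
        have := ha.ne_zero
        simpa [this] using hdd.symm
      rw [h0] at hk
      exact pow_ne_zero k hϖ.ne_zero (hk.eq_zero_iff.1 rfl)
    obtain ⟨k', hk'⟩ := IsDiscreteValuationRing.associated_pow_irreducible hd0 hϖ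
    have hkk : k = k' + 2 := by
      have h1 : Associated (ϖ ^ (k' + 2)) (ϖ ^ k) := by
        have h3 : Associated (ϖ ^ 2 * d') (ϖ ^ 2 * ϖ ^ k') := hk'.mul_left _
        rw [hdd, ← pow_add, add_comm] at h3
        exact h3.symm.trans ((associated_unit_mul_left _ _ (ha.pow 2)).trans hk)
      have h4 := (pow_dvd_pow_iff hϖ.ne_zero hϖ.not_isUnit).1 h1.dvd
      have h5 := (pow_dvd_pow_iff hϖ.ne_zero hϖ.not_isUnit).1 h1.symm.dvd
      omega
    have hcard : (S (Function.update A j c')).card ≤ Fintype.card ι := Finset.card_le_univ _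
    refine Nat.find_min hex
      (m := (Fintype.card ι + 1) * k' + (S (Function.update A j c')).card) ?_
      ⟨x', _, d', k', hA', hd', hk', rfl⟩
    rw [hN, hkk]
    nlinarith

end Local

/-! ### Anisotropic forms over local fields -/

section Local

open IsLocalRing QuadraticMap

variable {O F V ι : Type*} [CommRing O] [IsDomain O] [IsDiscreteValuationRing O]
  [HenselianLocalRing O] [Field F] [Algebra O F] [IsFractionRing O F]
  [AddCommGroup V] [Module F V]

omit [IsDomain O] [IsDiscreteValuationRing O] [HenselianLocalRing O] [IsFractionRing O F] in
theorem sum_extend_smul [Fintype ι] {κ : Type*} [Fintype κ] {e : κ → ι}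
    (he : Function.Injective e) (a : κ → O) (x : ι → V) :
    ∑ i, algebraMap O F (Function.extend e a 0 i) • x i = ∑ j, algebraMap O F (a j) • x (e j) := by
  refine (Fintype.sum_of_injective e he _ _ ?_ ?_).symm
  · intro i hi
    rw [Function.extend_apply' _ _ _ (by simpa using hi)]
    simp
  · intro j
    rw [he.extend_apply]

/-- The shape of an anisotropic form over a local field: it has a basis such that at most two of
the basis vectors have a value that is a unit (those in `S`), and at most two have a value divisible
by the uniformizer; the basis is extremal in the sense of `exists_extremal_family`. Chevalley–Warning
supplies, for three vectors of either kind, a combination that extremality forbids. -/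
theorem exists_extremal_family_card_le [Finite (ResidueField O)] [Fintype ι]
    {q : QuadraticForm F V} (hq : q.Anisotropic) (h2 : (2 : F) ≠ 0) {b : ι → V}
    (hb : LinearIndependent F b) :
    ∃ (x : ι → V) (A : ι → O) (S : Finset ι), (∀ i, q (x i) = algebraMap O F (A i)) ∧
      (∀ i, i ∈ S ↔ A i ∉ maximalIdeal O) ∧ S.card ≤ 2 ∧ Fintype.card ι ≤ S.card + 2 ∧
      ∀ (a : ι → O) (j : ι) (c : O), IsUnit (a j) →
        q (∑ i, algebraMap O F (a i) • x i) = algebraMap O F c →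
        (c ∈ maximalIdeal O → A j ∈ maximalIdeal O) ∧ c ∉ maximalIdeal O ^ 2 := by
  classical
  obtain ⟨x, A, hA, hext⟩ := exists_extremal_family (O := O) hq h2 hb
  obtain ⟨ϖ, hϖ⟩ := IsDiscreteValuationRing.exists_irreducible O
  have hϖ0 : algebraMap O F ϖ ≠ 0 := by simpa using hϖ.ne_zero
  refine ⟨x, A, Finset.univ.filter fun i => A i ∉ maximalIdeal O, hA,
    fun i => by rw [Finset.mem_filter_univ], ?_, ?_, hext⟩
  · by_contra! hcard
    obtain ⟨i, j, l, hi, hj, hl, hij, hil, hjl⟩ := Finset.two_lt_card_iff.1 hcard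
    simp only [Finset.mem_filter, Finset.mem_univ, true_and] at hi hj hl
    have he : Function.Injective ![i, j, l] := by
      intro s t
      fin_cases s <;> fin_cases t <;> simp [hij, hil, hjl, hij.symm, hil.symm, hjl.symm]
    obtain ⟨a, ⟨s, hs⟩, c, hc, hqc⟩ := exists_primitive_combination hq
      (y := x ∘ ![i, j, l]) (fun s => ⟨_, hA _⟩)
    have h1 := (hext (Function.extend ![i, j, l] a 0) (![i, j, l] s) c
      (by rwa [he.extend_apply]) (by rw [sum_extend_smul he]; exact hqc)).1 hc
    fin_cases s
    exacts [hi h1, hj h1, hl h1]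
  · by_contra! hcard
    have hcard' : 2 < (Finset.univ.filter fun i => ¬ A i ∉ maximalIdeal O).card := by
      have := Finset.card_filter_add_card_filter_not (s := (Finset.univ : Finset ι))
        (fun i => A i ∉ maximalIdeal O)
      rw [Finset.card_univ] at this
      omega
    obtain ⟨i, j, l, hi, hj, hl, hij, hil, hjl⟩ := Finset.two_lt_card_iff.1 hcard'
    simp only [Finset.mem_filter, Finset.mem_univ, true_and, not_not] at hi hj hl
    have he : Function.Injective ![i, j, l] := by
      intro s t
      fin_cases s <;> fin_cases t <;> simp [hij, hil, hjl, hij.symm, hil.symm, hjl.symm]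
    -- on these vectors the rescaled form `ϖ⁻¹ q` is integral
    have hq' : ((algebraMap O F ϖ)⁻¹ • q).Anisotropic := by
      intro v hv
      refine hq v ?_
      simpa [hϖ.ne_zero] using hv
    have hint : ∀ s, ∃ d : O, ((algebraMap O F ϖ)⁻¹ • q) ((x ∘ ![i, j, l]) s) =
        algebraMap O F d := by
      intro s
      have hs : A (![i, j, l] s) ∈ maximalIdeal O := by
        fin_cases s
        exacts [hi, hj, hl]
      rw [hϖ.maximalIdeal_eq, Ideal.mem_span_singleton] at hs
      obtain ⟨d, hd⟩ := hs
      refine ⟨d, ?_⟩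
      rw [_root_.smul_apply, Function.comp_apply, hA, hd, map_mul, smul_eq_mul]
      field_simp
    obtain ⟨a, ⟨s, hs⟩, c, hc, hqc⟩ := exists_primitive_combination hq' hint
    refine (hext (Function.extend ![i, j, l] a 0) (![i, j, l] s) (ϖ * c)
      (by rwa [he.extend_apply]) ?_).2 ?_
    · rw [sum_extend_smul he, map_mul, ← hqc, _root_.smul_apply, smul_eq_mul]
      simp only [Function.comp_apply]
      field_simp
    · rw [pow_two]
      exact Ideal.mul_mem_mul (by rw [hϖ.maximalIdeal_eq]; exact Ideal.mem_span_singleton_self ϖ) hc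

variable (O) in
/-- A quadratic form in more than four variables over a local field is isotropic. -/
theorem card_le_four_of_anisotropic [Finite (ResidueField O)] [Fintype ι]
    {q : QuadraticForm F V} (hq : q.Anisotropic) (h2 : (2 : F) ≠ 0) {b : ι → V}
    (hb : LinearIndependent F b) : Fintype.card ι ≤ 4 := by
  obtain ⟨_, _, S, _, _, h1, h3, _⟩ := exists_extremal_family_card_le (O := O) hq h2 hb
  omega

/-- A `4 × 4` Gram determinant is a square modulo `4`; here this is made explicit for a form whose
last two basis vectors have values divisible by `ϖ` and are orthogonal modulo `ϖ` to everything. -/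
theorem det_gram_four {R : Type*} [CommRing R] (ϖ a b d e f g c₁ c₂ c₃ c₄ : R) :
    (!![2 * a, b, ϖ * c₁, ϖ * c₂; b, 2 * d, ϖ * c₃, ϖ * c₄;
        ϖ * c₁, ϖ * c₃, 2 * (ϖ * e), ϖ * f; ϖ * c₂, ϖ * c₄, ϖ * f, 2 * (ϖ * g)] :
      Matrix (Fin 4) (Fin 4) R).det =
    ϖ ^ 2 * ((b * f - ϖ * (c₁ * c₄ - c₂ * c₃)) ^ 2 -
      4 * (f ^ 2 * (a * d) + b ^ 2 * (e * g) - 4 * (a * d) * (e * g) +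
        ϖ * (d * (g * c₁ ^ 2 - f * (c₁ * c₂) + e * c₂ ^ 2) +
          a * (g * c₃ ^ 2 - f * (c₃ * c₄) + e * c₄ ^ 2) -
          b * (g * (c₁ * c₃) + e * (c₂ * c₄)) + b * f * (c₂ * c₃)))) := by
  rw [Matrix.det_succ_row_zero]
  simp [Fin.sum_univ_succ, Matrix.det_fin_three, Fin.succAbove]
  ring

variable (O) in
/-- The determinant of a four-dimensional anisotropic form over a local field is a square. -/
theorem isSquare_det_polarGram_of_anisotropic [Finite (ResidueField O)]
    {q : QuadraticForm F V} (hq : q.Anisotropic) (h2 : (2 : F) ≠ 0) (b : Module.Basis (Fin 4) F V) :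
    IsSquare (polarGram q b).det := by
  classical
  obtain ⟨x, A, S, hA, hS, hS1, hS2, hext⟩ :=
    exists_extremal_family_card_le (O := O) hq h2 b.linearIndependent
  obtain ⟨ϖ, hϖ⟩ := IsDiscreteValuationRing.exists_irreducible O
  have hϖ0 : algebraMap O F ϖ ≠ 0 := by simpa using hϖ.ne_zero
  have hdvd : ∀ {z : O}, z ∈ maximalIdeal O → ∃ c, z = ϖ * c := by
    intro z hz
    rwa [hϖ.maximalIdeal_eq, Ideal.mem_span_singleton] at hz
  rw [Fintype.card_fin] at hS2
  obtain ⟨i, j, hij, hSij⟩ := Finset.card_eq_two.1 (show S.card = 2 by omega)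
  have hSc : Sᶜ.card = 2 := by rw [Finset.card_compl, Fintype.card_fin]; omega
  obtain ⟨l, m, hlm, hSlm⟩ := Finset.card_eq_two.1 hSc
  have hi : i ∈ S := by simp [hSij]
  have hj : j ∈ S := by simp [hSij]
  have hl : l ∉ S := by rw [← Finset.mem_compl]; simp [hSlm]
  have hm : m ∉ S := by rw [← Finset.mem_compl]; simp [hSlm]
  rw [hS] at hi hj
  rw [hS, not_not] at hl hm
  -- the values and the polar products of the basis vectors
  obtain ⟨B, hB⟩ := exists_polar_eq hq (hA i) (hA j)
  obtain ⟨e, he⟩ := hdvd hl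
  obtain ⟨g, hg⟩ := hdvd hm
  have hc : ∀ s t, A t ∈ maximalIdeal O → ∃ c, polar q (x s) (x t) = algebraMap O F (ϖ * c) := by
    intro s t ht
    obtain ⟨z, hz, hz'⟩ := exists_polar_eq_mem hq (hA t) (hA s) ht
    obtain ⟨c, rfl⟩ := hdvd hz
    exact ⟨c, by rw [polar_comm, hz']⟩
  obtain ⟨c₁, hc₁⟩ := hc i l hl
  obtain ⟨c₂, hc₂⟩ := hc i m hm
  obtain ⟨c₃, hc₃⟩ := hc j l hl
  obtain ⟨c₄, hc₄⟩ := hc j m hm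
  obtain ⟨f, hf⟩ := hc l m hm
  -- both residue forms are anisotropic
  have hpair : ∀ {s t : Fin 4}, s ≠ t → ∀ (u v : O), ∀ c, q (algebraMap O F u • x s +
      algebraMap O F v • x t) = algebraMap O F c → ∀ w, (w = s ∧ IsUnit u ∨ w = t ∧ IsUnit v) →
      (c ∈ maximalIdeal O → A w ∈ maximalIdeal O) ∧ c ∉ maximalIdeal O ^ 2 := by
    intro s t hst u v c hqc w hw
    have hinj : Function.Injective ![s, t] := by
      intro y z
      fin_cases y <;> fin_cases z <;> simp [hst, hst.symm]
    refine hext (Function.extend ![s, t] ![u, v] 0) w c ?_ ?_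
    · rcases hw with ⟨rfl, hw⟩ | ⟨rfl, hw⟩
      · have := hinj.extend_apply ![u, v] 0 0
        simp only [Matrix.cons_val_zero] at this
        rwa [this]
      · have := hinj.extend_apply ![u, v] 0 1
        simp only [Matrix.cons_val_one, Matrix.cons_val_zero] at this
        rwa [this]
    · rw [sum_extend_smul hinj]
      simpa using hqc
  have hval : ∀ {s t : Fin 4} {z : O}, polar q (x s) (x t) = algebraMap O F z → ∀ u v : O,
      q (algebraMap O F u • x s + algebraMap O F v • x t) =
        algebraMap O F (A s * u ^ 2 + z * (u * v) + A t * v ^ 2) := by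
    intro s t z hz u v
    rw [QuadraticMap.map_add q, QuadraticMap.map_smul, QuadraticMap.map_smul, polar_smul_left,
      polar_smul_right, hz, hA, hA]
    simp only [smul_eq_mul, map_add, map_mul, map_pow]
    ring
  have hunit : ∀ {u : O}, residue O u ≠ 0 → IsUnit u := by
    intro u hu
    by_contra h
    exact hu ((residue_eq_zero_iff u).2 h)
  have han₁ : IsAnisotropicBinary (residue O (A i)) (residue O B) (residue O (A j)) := by
    intro u v huv
    obtain ⟨u, rfl⟩ := residue_surjective u
    obtain ⟨v, rfl⟩ := residue_surjective v
    have hmem : A i * u ^ 2 + B * (u * v) + A j * v ^ 2 ∈ maximalIdeal O := by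
      rw [← residue_eq_zero_iff]
      simpa using huv
    have h := hpair hij u v _ (hval hB u v)
    constructor
    · by_contra hu
      exact hi ((h i (Or.inl ⟨rfl, hunit hu⟩)).1 hmem)
    · by_contra hv
      exact hj ((h j (Or.inr ⟨rfl, hunit hv⟩)).1 hmem)
  have han₂ : IsAnisotropicBinary (residue O e) (residue O f) (residue O g) := by
    intro u v huv
    obtain ⟨u, rfl⟩ := residue_surjective u
    obtain ⟨v, rfl⟩ := residue_surjective v
    have hmem : e * u ^ 2 + f * (u * v) + g * v ^ 2 ∈ maximalIdeal O := by
      rw [← residue_eq_zero_iff]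
      simpa using huv
    have hmem' : A l * u ^ 2 + ϖ * f * (u * v) + A m * v ^ 2 ∈ maximalIdeal O ^ 2 := by
      have : A l * u ^ 2 + ϖ * f * (u * v) + A m * v ^ 2 =
          ϖ * (e * u ^ 2 + f * (u * v) + g * v ^ 2) := by rw [he, hg]; ring
      rw [this, pow_two]
      exact Ideal.mul_mem_mul (by rw [hϖ.maximalIdeal_eq]; exact Ideal.mem_span_singleton_self ϖ)
        hmem
    have h := hpair hlm u v _ (hval hf u v)
    constructor
    · by_contra hu
      exact (h l (Or.inl ⟨rfl, hunit hu⟩)).2 hmem'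
    · by_contra hv
      exact (h m (Or.inr ⟨rfl, hunit hv⟩)).2 hmem'
  -- Hensel's lemma lifts the square root of the discriminant
  set P := B * f - ϖ * (c₁ * c₄ - c₂ * c₃) with hP
  set R := f ^ 2 * (A i * A j) + B ^ 2 * (e * g) - 4 * (A i * A j) * (e * g) +
        ϖ * (A j * (g * c₁ ^ 2 - f * (c₁ * c₂) + e * c₂ ^ 2) +
          A i * (g * c₃ ^ 2 - f * (c₃ * c₄) + e * c₄ ^ 2) -
          B * (g * (c₁ * c₃) + e * (c₂ * c₄)) + B * f * (c₂ * c₃)) with hR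
  have hresϖ : residue O ϖ = 0 := by
    rw [residue_eq_zero_iff, hϖ.maximalIdeal_eq]
    exact Ideal.mem_span_singleton_self ϖ
  obtain ⟨t, ht, ht'⟩ := han₁.exists_simple_root han₂
  obtain ⟨t, rfl⟩ := residue_surjective t
  have hroot : t ^ 2 - P * t + R ∈ maximalIdeal O := by
    rw [← residue_eq_zero_iff, hP, hR]
    simp only [map_add, map_sub, map_mul, map_pow, hresϖ, map_ofNat]
    linear_combination ht
  have hsimple : residue O (2 * t - P) ≠ 0 := by
    rw [hP]
    simp only [map_sub, map_mul, hresϖ, map_ofNat]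
    simpa using ht'
  obtain ⟨s, hs, hst⟩ := exists_quadratic_root hroot (hunit hsimple)
  have hs0 : 2 * s - P ≠ 0 := by
    intro h0
    apply hsimple
    rw [residue_eq_zero_iff]
    have : 2 * t - P = 2 * s - P - 2 * (s - t) := by ring
    rw [this, h0, zero_sub]
    exact neg_mem (Ideal.mul_mem_left _ _ hst)
  let y : Fin 4 → V := ![x i, x j, x l, x m]
  have hdet : (polarGram q y).det = algebraMap O F (ϖ * (2 * s - P)) ^ 2 := by
    have hself : ∀ w, polar q (x w) (x w) = algebraMap O F (2 * A w) := by
      intro w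
      rw [polar_self, hA, two_smul, map_mul, map_ofNat, two_mul]
    have hmat : polarGram q y = (algebraMap O F).mapMatrix
        !![2 * A i, B, ϖ * c₁, ϖ * c₂; B, 2 * A j, ϖ * c₃, ϖ * c₄;
          ϖ * c₁, ϖ * c₃, 2 * (ϖ * e), ϖ * f; ϖ * c₂, ϖ * c₄, ϖ * f, 2 * (ϖ * g)] := by
      rw [← he, ← hg]
      ext u v
      fin_cases u <;> fin_cases v <;>
        simp only [polarGram, y, Matrix.of_apply, RingHom.mapMatrix_apply, Matrix.map_apply] <;>
        first
        | exact hself _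
        | assumption
        | (rw [polar_comm]; assumption)
    rw [hmat, ← RingHom.map_det, det_gram_four, ← map_pow]
    congr 1
    linear_combination (-4 * ϖ ^ 2) * hs
  have hrepr : y = fun u => ∑ v, b.repr (y u) v • b v := by
    ext u
    exact (b.sum_repr (y u)).symm
  rw [hrepr] at hdet
  replace hdet :=
    (det_polarGram_linearCombination q b (Matrix.of fun u v => b.repr (y u) v)).symm.trans hdet
  have hP0 : (Matrix.of fun u v => b.repr (y u) v).det ≠ 0 := by
    intro h0
    rw [h0, zero_pow two_ne_zero, zero_mul] at hdet
    have := pow_eq_zero_iff two_ne_zero |>.1 hdet.symm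
    rw [map_mul] at this
    rcases mul_eq_zero.1 this with h | h
    · exact hϖ0 h
    · exact hs0 ((IsFractionRing.injective O F) (by rw [h, map_zero]))
  refine ⟨algebraMap O F (ϖ * (2 * s - P)) / (Matrix.of fun u v => b.repr (y u) v).det, ?_⟩
  field_simp
  linear_combination hdet

end Local

/-! ### Splitting off hyperbolic planes -/

section Witt

open QuadraticMap

variable {F V V' : Type*} [Field F] [AddCommGroup V] [Module F V] [AddCommGroup V'] [Module F V']

theorem hyperbolicSpace_apply (m : ℕ) (h : Fin m → Fin 2 → F) :
    hyperbolicSpace F m h = ∑ i, (h i 0 ^ 2 - h i 1 ^ 2) := by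
  simp only [hyperbolicSpace, pi_apply, weightedSumSquares_apply, Fin.sum_univ_two,
    Matrix.cons_val_zero, Matrix.cons_val_one, smul_eq_mul]
  refine Finset.sum_congr rfl fun i _ => ?_
  ring

theorem hyperbolicSpace_succ_equivalent (m : ℕ) :
    ((hyperbolicSpace F m).prod (weightedSumSquares F ![(1 : F), -1])).Equivalent
      (hyperbolicSpace F (m + 1)) := by
  refine ⟨{ toLinearEquiv := (LinearEquiv.prodComm F _ _).trans
              (Fin.consLinearEquiv F fun _ : Fin (m + 1) => Fin 2 → F)
            map_app' := fun x => ?_ }⟩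
  change hyperbolicSpace F (m + 1) (Fin.cons x.2 x.1) = _
  rw [hyperbolicSpace_apply, Fin.sum_univ_succ, prod_apply, hyperbolicSpace_apply]
  simp [weightedSumSquares_apply, Fin.sum_univ_two]
  ring

theorem QuadraticMap.Equivalent.finrank_eq {Q : QuadraticForm F V} {Q' : QuadraticForm F V'}
    (h : Q.Equivalent Q') : Module.finrank F V = Module.finrank F V' := by
  obtain ⟨e⟩ := h
  exact e.toLinearEquiv.finrank_eq

theorem prod_assoc_equivalent {V'' : Type*} [AddCommGroup V''] [Module F V'']
    (Q : QuadraticForm F V) (Q' : QuadraticForm F V') (Q'' : QuadraticForm F V'') :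
    ((Q.prod Q').prod Q'').Equivalent (Q.prod (Q'.prod Q'')) :=
  ⟨{ toLinearEquiv := LinearEquiv.prodAssoc F V V' V''
     map_app' := fun x => by simp [add_assoc] }⟩

/-- A nondegenerate isotropic form splits off a hyperbolic plane, with nondegenerate complement. -/
theorem exists_equivalent_prod_hyperbolicPlane (h2 : (2 : F) ≠ 0) {Q : QuadraticForm F V}
    (hQ : ∀ x, (∀ y, polar Q x y = 0) → x = 0) {v : V} (hv : Q v = 0) (hv0 : v ≠ 0) :
    ∃ W : Submodule F V,
      ((Q.comp W.subtype).prod (weightedSumSquares F ![(1 : F), -1])).Equivalent Q ∧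
      ∀ x : W, (∀ y, polar (Q.comp W.subtype) x y = 0) → x = 0 := by
  obtain ⟨w₀, hw₀⟩ : ∃ w, polar Q v w ≠ 0 := by
    by_contra! h
    exact hv0 (hQ v h)
  -- a vector `w` forming a hyperbolic pair with `v`
  obtain ⟨w₁, hw₁⟩ : ∃ w₁, polar Q v w₁ = 1 :=
    ⟨(polar Q v w₀)⁻¹ • w₀, by rw [polar_smul_right, smul_eq_mul, inv_mul_cancel₀ hw₀]⟩
  let w := w₁ - Q w₁ • v
  have hvv : polar Q v v = 0 := by rw [polar_self, hv, smul_zero]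
  have hvw : polar Q v w = 1 := by
    simp only [w, polar_sub_right, polar_smul_right, hw₁, hvv, smul_zero, sub_zero]
  have hw : Q w = 0 := by
    have : w = w₁ + (-Q w₁) • v := by simp only [w, neg_smul, sub_eq_add_neg]
    rw [this, QuadraticMap.map_add Q, QuadraticMap.map_smul, polar_smul_right, hv,
      polar_comm, hw₁]
    simp
  have hww : polar Q w w = 0 := by rw [polar_self, hw, smul_zero]
  have hwv : polar Q w v = 1 := by rw [polar_comm, hvw]
  let W : Submodule F V := (polarBilin Q v).ker ⊓ (polarBilin Q w).ker
  have hWv : ∀ u : W, polar Q u v = 0 := fun u => by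
    rw [polar_comm]; exact LinearMap.mem_ker.1 u.2.1
  have hWw : ∀ u : W, polar Q u w = 0 := fun u => by
    rw [polar_comm]; exact LinearMap.mem_ker.1 u.2.2
  let T : (W × (Fin 2 → F)) →ₗ[F] V :=
    { toFun := fun x => (x.1 : V) + ((x.2 0 + x.2 1) • v + (x.2 0 - x.2 1) • w)
      map_add' := fun x y => by simp; module
      map_smul' := fun c x => by simp; module }
  have hT : ∀ x, T x = (x.1 : V) + ((x.2 0 + x.2 1) • v + (x.2 0 - x.2 1) • w) := fun _ => rfl
  have hTv : ∀ x, polar Q (T x) v = x.2 0 - x.2 1 := by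
    intro x
    rw [hT, polar_add_left, polar_add_left, polar_smul_left, polar_smul_left, hWv, hvv, hwv]
    simp
  have hTw : ∀ x, polar Q (T x) w = x.2 0 + x.2 1 := by
    intro x
    rw [hT, polar_add_left, polar_add_left, polar_smul_left, polar_smul_left, hWw, hvw, hww]
    simp
  have hinj : Function.Injective T := by
    rw [← LinearMap.ker_eq_bot, LinearMap.ker_eq_bot']
    intro x hx
    have h3 := hTv x
    have h4 := hTw x
    rw [hx, polar_zero_left] at h3 h4
    have h0 : x.2 0 = 0 := by
      have : 2 * x.2 0 = 0 := by linear_combination -h3 - h4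
      exact (mul_eq_zero.1 this).resolve_left h2
    have h1 : x.2 1 = 0 := by linear_combination h3 + h0
    rw [hT, h0, h1] at hx
    refine Prod.ext (Subtype.ext ?_) (funext fun i => ?_)
    · simpa using hx
    · fin_cases i
      exacts [h0, h1]
  have hsurj : Function.Surjective T := by
    intro z
    refine ⟨⟨⟨z - (polar Q z w • v + polar Q z v • w), ?_⟩,
      ![(polar Q z w + polar Q z v) / 2, (polar Q z w - polar Q z v) / 2]⟩, ?_⟩
    · constructor
      · change polar Q v _ = 0
        rw [polar_sub_right, polar_add_right, polar_smul_right, polar_smul_right, hvv, hvw,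
          polar_comm Q v z]
        simp
      · change polar Q w _ = 0
        rw [polar_sub_right, polar_add_right, polar_smul_right, polar_smul_right, hww, hwv,
          polar_comm Q w z]
        simp
    · rw [hT]
      simp only [Matrix.cons_val_zero, Matrix.cons_val_one]
      have h3 : (polar Q z w + polar Q z v) / 2 + (polar Q z w - polar Q z v) / 2 =
          polar Q z w := by field_simp; ring
      have h4 : (polar Q z w + polar Q z v) / 2 - (polar Q z w - polar Q z v) / 2 =
          polar Q z v := by field_simp; ring
      rw [h3, h4, sub_add_cancel]
  refine ⟨W, ⟨{ toLinearEquiv := LinearEquiv.ofBijective T ⟨hinj, hsurj⟩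
                map_app' := fun x => ?_ }⟩, fun x hx => ?_⟩
  · change Q (T x) = _
    rw [hT, QuadraticMap.map_add Q, QuadraticMap.map_add Q (_ • v), polar_add_right,
      QuadraticMap.map_smul, QuadraticMap.map_smul]
    simp only [polar_smul_left, polar_smul_right, hWv, hWw, hv, hw, hvw]
    simp [weightedSumSquares_apply, Fin.sum_univ_two]
    ring
  · apply Subtype.ext
    refine hQ _ fun z => ?_
    obtain ⟨y, rfl⟩ := hsurj z
    rw [hT, polar_add_right, polar_add_right, polar_smul_right, polar_smul_right, hWv, hWw]
    have h : polar Q (x : V) (y.1 : V) = 0 := hx y.1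
    rw [h, smul_zero, smul_zero, add_zero, add_zero]

/-- Witt decomposition: a nondegenerate form is the orthogonal sum of an anisotropic form and a
hyperbolic space. -/
theorem exists_isAnisotropicPart (h2 : (2 : F) ≠ 0) [FiniteDimensional F V]
    (Q : QuadraticForm F V) (hQ : ∀ x, (∀ y, polar Q x y = 0) → x = 0) :
    ∃ (d : ℕ) (ψ : QuadraticForm F (Fin d → F)), IsAnisotropicPart Q ψ := by
  induction hn : Module.finrank F V using Nat.strong_induction_on generalizing V with
  | _ n ih =>
  by_cases han : Q.Anisotropic
  · let b := Module.finBasis F V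
    let ψ : QuadraticForm F (Fin (Module.finrank F V) → F) := Q.comp b.equivFun.symm
    let e := b.equivFun.trans (LinearEquiv.prodUnique (R := F) (M₂ := Fin 0 → Fin 2 → F)).symm
    refine ⟨_, ψ, fun x hx => ?_, 0, ⟨{ toLinearEquiv := e, map_app' := fun x => ?_ }⟩⟩
    · exact b.equivFun.symm.map_eq_zero_iff.1 (han _ hx)
    · change (ψ.prod (hyperbolicSpace F 0)) (b.equivFun x, _) = Q x
      rw [prod_apply, hyperbolicSpace_apply]
      simp [ψ]
  · obtain ⟨v, hv, hv0⟩ : ∃ v, Q v = 0 ∧ v ≠ 0 := by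
      simpa [Anisotropic] using han
    obtain ⟨W, hW, hWnd⟩ := exists_equivalent_prod_hyperbolicPlane h2 hQ hv hv0
    have hdim := hW.finrank_eq
    rw [Module.finrank_prod, Module.finrank_fin_fun] at hdim
    obtain ⟨d, ψ, hψ, m, hm⟩ := ih (Module.finrank F W) (by omega) (Q.comp W.subtype) hWnd rfl
    refine ⟨d, ψ, hψ, m + 1, ?_⟩
    exact hW.symm.trans ((Equivalent.prod hm (Equivalent.refl _)).trans
      ((prod_assoc_equivalent _ _ _).trans
        (Equivalent.prod (Equivalent.refl _) (hyperbolicSpace_succ_equivalent m))))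

/-! ### Totally isotropic subspaces -/

/-- In `ψ ⊥ m⟨1, -1⟩` with `ψ` anisotropic, a totally isotropic subspace has dimension at most `m`:
writing `X` for the standard Lagrangian of the hyperbolic part, `U ∩ X^⊥ = U ∩ X`, and
`U / (U ∩ X)` embeds into the space of linear forms on `X` that vanish on `U ∩ X`. This bound takes
the place of Witt's cancellation theorem. -/
theorem finrank_le_of_isAnisotropic {ψ : QuadraticForm F V} (hψ : ψ.Anisotropic)
    (h2 : (2 : F) ≠ 0) [FiniteDimensional F V] {m : ℕ}
    (U : Submodule F (V × (Fin m → Fin 2 → F)))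
    (hU : ∀ u ∈ U, ψ.prod (hyperbolicSpace F m) u = 0) : Module.finrank F U ≤ m := by
  -- `D` vanishes exactly on `X^⊥`
  let D : U →ₗ[F] (Fin m → F) :=
    { toFun := fun u i => (u : V × (Fin m → Fin 2 → F)).2 i 0 -
        (u : V × (Fin m → Fin 2 → F)).2 i 1
      map_add' := fun u u' => by ext i; simp; ring
      map_smul' := fun c u => by ext i; simp; ring }
  let S : D.ker →ₗ[F] (Fin m → F) :=
    { toFun := fun u i => ((u : U) : V × (Fin m → Fin 2 → F)).2 i 0 +
        ((u : U) : V × (Fin m → Fin 2 → F)).2 i 1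
      map_add' := fun u u' => by ext i; simp; ring
      map_smul' := fun c u => by ext i; simp; ring }
  have hker : ∀ u : D.ker, ∀ i, ((u : U) : V × (Fin m → Fin 2 → F)).2 i 0 =
      ((u : U) : V × (Fin m → Fin 2 → F)).2 i 1 := fun u i =>
    sub_eq_zero.1 (congrFun (LinearMap.mem_ker.1 u.2) i)
  have hfst : ∀ u : D.ker, ((u : U) : V × (Fin m → Fin 2 → F)).1 = 0 := by
    intro u
    have h := hU _ (u : U).2
    rw [prod_apply, hyperbolicSpace_apply] at h
    simp only [hker, sub_self, Finset.sum_const_zero, add_zero] at h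
    exact hψ _ h
  have hS : Function.Injective S := by
    intro u u' h
    refine Subtype.ext (Subtype.ext (Prod.ext ((hfst u).trans (hfst u').symm) ?_))
    have h1 : ∀ i, ((u : U) : V × (Fin m → Fin 2 → F)).2 i 1 =
        ((u' : U) : V × (Fin m → Fin 2 → F)).2 i 1 := by
      intro i
      have : ((u : U) : V × (Fin m → Fin 2 → F)).2 i 0 +
        ((u : U) : V × (Fin m → Fin 2 → F)).2 i 1 = ((u' : U) : V × (Fin m → Fin 2 → F)).2 i 0 +
        ((u' : U) : V × (Fin m → Fin 2 → F)).2 i 1 := congrFun h i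
      rw [hker, hker, ← two_mul, ← two_mul] at this
      exact mul_left_cancel₀ h2 this
    funext i j
    fin_cases j
    · exact (hker u i).trans ((h1 i).trans (hker u' i).symm)
    · exact h1 i
  have horth : ∀ (u : D.ker) (u' : U), ∑ i, D u' i * S u i = 0 := by
    intro u u'
    have h := hU _ (U.add_mem (u : U).2 u'.2)
    have h' := hU _ u'.2
    rw [prod_apply, hyperbolicSpace_apply] at h h'
    simp only [Prod.fst_add, Prod.snd_add, Pi.add_apply, hfst, zero_add, hker] at h
    have : ∑ i, D u' i * S u i =
        ∑ i, ((((u : U) : V × (Fin m → Fin 2 → F)).2 i 1 +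
            (u' : V × (Fin m → Fin 2 → F)).2 i 0) ^ 2 -
          (((u : U) : V × (Fin m → Fin 2 → F)).2 i 1 +
            (u' : V × (Fin m → Fin 2 → F)).2 i 1) ^ 2) -
        ∑ i, ((u' : V × (Fin m → Fin 2 → F)).2 i 0 ^ 2 -
          (u' : V × (Fin m → Fin 2 → F)).2 i 1 ^ 2) := by
      rw [← Finset.sum_sub_distrib]
      refine Finset.sum_congr rfl fun i _ => ?_
      change ((u' : V × (Fin m → Fin 2 → F)).2 i 0 - (u' : V × (Fin m → Fin 2 → F)).2 i 1) *
        (((u : U) : V × (Fin m → Fin 2 → F)).2 i 0 +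
          ((u : U) : V × (Fin m → Fin 2 → F)).2 i 1) = _
      rw [hker]
      ring
    rw [this]
    linear_combination h - h'
  have hle : D.range.map (dotProductEquiv F (Fin m)).toLinearMap ≤ S.range.dualAnnihilator := by
    rintro _ ⟨_, ⟨u', rfl⟩, rfl⟩
    rw [Submodule.mem_dualAnnihilator]
    rintro _ ⟨u, rfl⟩
    exact horth u u'
  have h1 := Submodule.finrank_mono hle
  rw [LinearEquiv.finrank_map_eq] at h1
  have h3 := Subspace.finrank_add_finrank_dualAnnihilator_eq S.range
  rw [Module.finrank_fin_fun, LinearMap.finrank_range_of_inj hS] at h3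
  have h4 := LinearMap.finrank_range_add_finrank_ker D
  omega

/-- The standard Lagrangian of a hyperbolic space. -/
theorem exists_isotropic_submodule_hyperbolicSpace (m : ℕ) :
    ∃ U : Submodule F (Fin m → Fin 2 → F), (∀ u ∈ U, hyperbolicSpace F m u = 0) ∧
      Module.finrank F U = m := by
  let f : (Fin m → F) →ₗ[F] (Fin m → Fin 2 → F) :=
    { toFun := fun s i _ => s i
      map_add' := fun s t => rfl
      map_smul' := fun c s => rfl }
  refine ⟨f.range, ?_, ?_⟩
  · rintro _ ⟨s, rfl⟩
    rw [hyperbolicSpace_apply]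
    simp [f]
  · rw [LinearMap.finrank_range_of_inj, Module.finrank_fin_fun]
    intro s t h
    funext i
    exact congrFun (congrFun h i) 0

theorem exists_isotropic_submodule_of_equivalent {Q : QuadraticForm F V}
    {Q' : QuadraticForm F V'} (h : Q.Equivalent Q') {U : Submodule F V} (hU : ∀ u ∈ U, Q u = 0) :
    ∃ U' : Submodule F V', (∀ u ∈ U', Q' u = 0) ∧ Module.finrank F U' = Module.finrank F U := by
  obtain ⟨e⟩ := h
  refine ⟨U.map e.toLinearEquiv.toLinearMap, ?_, LinearEquiv.finrank_map_eq _ _⟩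
  rintro _ ⟨u, hu, rfl⟩
  exact (e.map_app u).trans (hU u hu)

theorem finrank_hyperbolicSpace (m : ℕ) : Module.finrank F (Fin m → Fin 2 → F) = 2 * m := by
  simp [Module.finrank_pi_fintype, mul_comm]

/-- An anisotropic part of a hyperbolic form is zero-dimensional. -/
theorem IsAnisotropicPart.eq_zero_of_isHyperbolic (h2 : (2 : F) ≠ 0) {Q : QuadraticForm F V}
    {e : ℕ} {ψ : QuadraticForm F (Fin e → F)} (hψ : IsAnisotropicPart Q ψ) (hQ : IsHyperbolic Q) :
    e = 0 := by
  obtain ⟨han, m, hm⟩ := hψ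
  obtain ⟨r, hr⟩ := hQ
  have hdim := (hr.symm.trans hm).finrank_eq
  rw [Module.finrank_prod, Module.finrank_fin_fun, finrank_hyperbolicSpace,
    finrank_hyperbolicSpace] at hdim
  obtain ⟨U, hU, hUr⟩ := exists_isotropic_submodule_hyperbolicSpace (F := F) r
  obtain ⟨U', hU', hUr'⟩ := exists_isotropic_submodule_of_equivalent (hr.symm.trans hm) hU
  have := finrank_le_of_isAnisotropic han h2 U' hU'
  omega

/-- If a form becomes hyperbolic by adding a one-dimensional form, its anisotropic part has
dimension at most one. -/
theorem IsAnisotropicPart.le_one_of_isHyperbolic_prod (h2 : (2 : F) ≠ 0) {Q : QuadraticForm F V}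
    {e : ℕ} {ψ : QuadraticForm F (Fin e → F)} (hψ : IsAnisotropicPart Q ψ) {c : F}
    (hQ : IsHyperbolic (Q.prod (unaryForm c))) : e ≤ 1 := by
  obtain ⟨han, m, hm⟩ := hψ
  obtain ⟨r, hr⟩ := hQ
  have heq := hr.symm.trans (Equivalent.prod hm (Equivalent.refl (unaryForm c)))
  have hdim := heq.finrank_eq
  rw [Module.finrank_prod, Module.finrank_prod, Module.finrank_fin_fun, finrank_hyperbolicSpace,
    finrank_hyperbolicSpace, Module.finrank_self] at hdim
  obtain ⟨U, hU, hUr⟩ := exists_isotropic_submodule_hyperbolicSpace (F := F) r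
  obtain ⟨U', hU', hUr'⟩ := exists_isotropic_submodule_of_equivalent heq hU
  -- intersect the Lagrangian with the hyperplane on which the last coordinate vanishes
  let p : U' →ₗ[F] F := LinearMap.snd F _ F ∘ₗ U'.subtype
  let i : p.ker →ₗ[F] ((Fin e → F) × (Fin m → Fin 2 → F)) :=
    LinearMap.fst F _ F ∘ₗ U'.subtype ∘ₗ p.ker.subtype
  have hlast : ∀ u : p.ker, ((u : U') : ((Fin e → F) × (Fin m → Fin 2 → F)) × F).2 = 0 :=
    fun u => LinearMap.mem_ker.1 u.2
  have hi : Function.Injective i := fun u u' h =>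
    Subtype.ext (Subtype.ext (Prod.ext h ((hlast u).trans (hlast u').symm)))
  have h1 := finrank_le_of_isAnisotropic han h2 i.range (by
    rintro _ ⟨u, rfl⟩
    have h := hU' _ (u : U').2
    rw [prod_apply, hlast, QuadraticMap.map_zero, add_zero] at h
    exact h)
  rw [LinearMap.finrank_range_of_inj hi] at h1
  have h3 := LinearMap.finrank_range_add_finrank_ker p
  have h4 : Module.finrank F p.range ≤ 1 := by
    simpa using Submodule.finrank_le p.range
  omega

end Witt

/-! ### Discriminants up to squares -/

section Discriminant

open QuadraticMap

variable {F V V' ι ι' : Type*} [Field F] [Invertible (2 : F)] [AddCommGroup V] [Module F V]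
  [AddCommGroup V'] [Module F V'] [Fintype ι] [DecidableEq ι] [Fintype ι'] [DecidableEq ι']

theorem toMatrix_apply_eq (Q : QuadraticForm F V) (b : Module.Basis ι F V) (i j : ι) :
    Q.toMatrix b i j = ⅟(2 : F) * polar Q (b i) (b j) := by
  rw [QuadraticForm.toMatrix, LinearMap.toMatrix₂_apply, associated_apply]
  simp [polar]

theorem det_polarGram_basis (Q : QuadraticForm F V) (b : Module.Basis ι F V) :
    (polarGram Q b).det = 2 ^ Fintype.card ι * Q.discr b := by
  rw [QuadraticForm.discr, ← Matrix.det_smul]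
  congr 1
  ext i j
  rw [Matrix.smul_apply, toMatrix_apply_eq, smul_eq_mul, mul_invOf_cancel_left]
  rfl

theorem discr_eq_of_equivalent {Q : QuadraticForm F V} {Q' : QuadraticForm F V'}
    (h : Q.Equivalent Q') (b : Module.Basis ι F V) (b' : Module.Basis ι' F V') :
    ∃ u : F, u ≠ 0 ∧ Q.discr b = u ^ 2 * Q'.discr b' := by
  obtain ⟨f⟩ := h
  let e : ι' ≃ ι := (b'.map f.toLinearEquiv.symm).indexEquiv b
  have hQ : Q = Q'.comp f.toLinearEquiv.toLinearMap := by
    ext x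
    exact (f.map_app x).symm
  have hre : Q'.discr (b'.reindex e) = Q'.discr b' := by
    rw [QuadraticForm.discr, QuadraticForm.discr, ← Matrix.det_submatrix_equiv_self e]
    congr 1
    ext i j
    simp [toMatrix_apply_eq]
  refine ⟨(LinearMap.toMatrix b (b'.reindex e) f.toLinearEquiv.toLinearMap).det, ?_, ?_⟩
  · exact (LinearEquiv.isUnit_det f.toLinearEquiv b (b'.reindex e)).ne_zero
  · conv_lhs => rw [hQ, QuadraticForm.discr_comp (b'.reindex e), hre]
    ring

theorem discr_prod (Q : QuadraticForm F V) (Q' : QuadraticForm F V') (b : Module.Basis ι F V)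
    (b' : Module.Basis ι' F V') :
    QuadraticForm.discr (b.prod b') (Q.prod Q') = Q.discr b * Q'.discr b' := by
  rw [QuadraticForm.discr, QuadraticForm.discr, QuadraticForm.discr, ← Matrix.det_fromBlocks_zero₂₁ _ 0]
  congr 1
  ext i j
  rw [toMatrix_apply_eq, polar_prod]
  rcases i with i | i <;> rcases j with j | j <;> simp [toMatrix_apply_eq]

theorem discr_weightedSumSquares (w : ι → F) :
    QuadraticForm.discr (Pi.basisFun F ι) (weightedSumSquares F w) = ∏ i, w i := by
  rw [QuadraticForm.discr, ← Matrix.det_diagonal]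
  congr 1
  ext i j
  rw [toMatrix_apply_eq, Matrix.diagonal_apply, polar]
  simp only [Pi.basisFun_apply, weightedSumSquares_apply, smul_eq_mul, ← Finset.sum_sub_distrib]
  have : ∀ l, (w l * ((Pi.single i 1 + Pi.single j 1 : ι → F) l *
        (Pi.single i 1 + Pi.single j 1 : ι → F) l) -
      w l * ((Pi.single i 1 : ι → F) l * (Pi.single i 1 : ι → F) l) -
      w l * ((Pi.single j 1 : ι → F) l * (Pi.single j 1 : ι → F) l)) =
      if l = i then (if i = j then 2 * w i else 0) else 0 := by
    intro l
    by_cases hli : l = i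
    · subst hli
      by_cases hlj : l = j
      · subst hlj; simp; ring
      · simp [hlj]
    · by_cases hlj : l = j
      · subst hlj; simp [hli]
      · simp [hli, hlj]
  simp only [this, Finset.sum_ite_eq', Finset.mem_univ, if_true]
  split_ifs
  · rw [← mul_assoc, invOf_mul_self, one_mul]
  · simp

omit [Invertible (2 : F)] in
theorem hyperbolicSpace_equivalent_weightedSumSquares (m : ℕ) :
    (hyperbolicSpace F m).Equivalent
      (weightedSumSquares F fun p : Fin m × Fin 2 => ![(1 : F), -1] p.2) := by
  refine ⟨{ toLinearEquiv := (LinearEquiv.curry F F (Fin m) (Fin 2)).symm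
            map_app' := fun x => ?_ }⟩
  change weightedSumSquares F _ (fun p : Fin m × Fin 2 => x p.1 p.2) = _
  rw [hyperbolicSpace_apply, weightedSumSquares_apply, Fintype.sum_prod_type]
  refine Finset.sum_congr rfl fun i _ => ?_
  simp [Fin.sum_univ_two]
  ring

/-- The discriminant of a form is, up to squares, `(-1) ^ m` times that of its anisotropic part,
where `m` is the number of hyperbolic planes split off. -/
theorem discr_eq_of_equivalent_prod_hyperbolicSpace {n e m : ℕ} {Q : QuadraticForm F V}
    (b : Module.Basis (Fin n) F V) {ψ : QuadraticForm F (Fin e → F)}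
    (h : Q.Equivalent (ψ.prod (hyperbolicSpace F m))) :
    ∃ u : F, u ≠ 0 ∧ Q.discr b = u ^ 2 * (ψ.discr (Pi.basisFun F (Fin e)) * (-1) ^ m) := by
  obtain ⟨u, hu, h1⟩ := discr_eq_of_equivalent
    (h.trans (Equivalent.prod (Equivalent.refl ψ)
      (hyperbolicSpace_equivalent_weightedSumSquares m))) b
    ((Pi.basisFun F (Fin e)).prod (Pi.basisFun F (Fin m × Fin 2)))
  refine ⟨u, hu, ?_⟩
  rw [h1, discr_prod, discr_weightedSumSquares, Fintype.prod_prod_type]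
  simp

/-- A binary form whose discriminant is minus a square is isotropic. -/
theorem not_isSquare_neg_discr_of_anisotropic {ψ : QuadraticForm F (Fin 2 → F)}
    (hψ : ψ.Anisotropic) : ¬ IsSquare (-ψ.discr (Pi.basisFun F (Fin 2))) := by
  rintro ⟨s, hs⟩
  have h2 : (2 : F) ≠ 0 := Invertible.ne_zero 2
  have hdet := det_polarGram_basis ψ (Pi.basisFun F (Fin 2))
  rw [Matrix.det_fin_two] at hdet
  simp only [polarGram, Matrix.of_apply, polar_self, two_smul, Fintype.card_fin] at hdet
  set x := Pi.basisFun F (Fin 2) 0 with hx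
  set y := Pi.basisFun F (Fin 2) 1 with hy
  rw [polar_comm ψ y x] at hdet
  have hx0 : ψ x ≠ 0 := by
    intro h
    exact (Pi.basisFun F (Fin 2)).ne_zero 0 (hψ _ h)
  have hz : ψ ((2 * s - polar ψ x y) • x + (2 * ψ x) • y) = 0 := by
    rw [QuadraticMap.map_add ψ, QuadraticMap.map_smul, QuadraticMap.map_smul, polar_smul_left,
      polar_smul_right]
    simp only [smul_eq_mul]
    linear_combination ψ x * hdet - 4 * ψ x * hs
  have h0 := congrFun (hψ _ hz) 1
  rw [hx, hy] at h0
  simp only [Pi.basisFun_apply, Pi.add_apply, Pi.smul_apply, Pi.single_eq_same, Pi.zero_apply,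
    smul_eq_mul, mul_one, ne_eq, one_ne_zero, not_false_eq_true, Pi.single_eq_of_ne, mul_zero,
    zero_add] at h0
  exact mul_ne_zero h2 hx0 (by simpa [hx] using h0)

end Discriminant

/-! ### The dimension of the anisotropic part over a local field -/

section LocalField

open QuadraticMap IsLocalRing

variable {F V V' : Type*} [Field F] [AddCommGroup V] [Module F V] [AddCommGroup V'] [Module F V']

theorem polar_nondegenerate_of_discr_ne_zero [Invertible (2 : F)] {n : ℕ}
    {Q : QuadraticForm F V} {b : Module.Basis (Fin n) F V} (hb : Q.discr b ≠ 0) (x : V)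
    (hx : ∀ y, polar Q x y = 0) : x = 0 := by
  refine (LinearMap.separatingLeft_iff_det_ne_zero b).2 hb x fun y => ?_
  have := hx y
  rw [polar] at this
  rw [associated_apply, this, smul_zero]

theorem IsAnisotropicPart.of_equivalent {W : Type*} [AddCommGroup W] [Module F W]
    {Q : QuadraticForm F V} {Q' : QuadraticForm F V'} (h : Q.Equivalent Q')
    {ψ : QuadraticForm F W} (hψ : IsAnisotropicPart Q ψ) : IsAnisotropicPart Q' ψ :=
  ⟨hψ.1, hψ.2.imp fun _ hm => h.symm.trans hm⟩

theorem AnisotropicPartHasDim.of_equivalent {Q : QuadraticForm F V} {Q' : QuadraticForm F V'}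
    (h : Q.Equivalent Q') {d : ℕ} (hd : AnisotropicPartHasDim Q d) :
    AnisotropicPartHasDim Q' d :=
  ⟨hd.1.imp fun _ hψ => hψ.of_equivalent h, fun e ψ hψ => hd.2 e ψ (hψ.of_equivalent h.symm)⟩

theorem IsHyperbolic.of_equivalent {Q : QuadraticForm F V} {Q' : QuadraticForm F V'}
    (h : Q.Equivalent Q') (hQ : IsHyperbolic Q) : IsHyperbolic Q' :=
  hQ.imp fun _ hm => h.symm.trans hm

theorem isHyperbolic_congr {Q : QuadraticForm F V} {Q' : QuadraticForm F V'}
    (h : Q.Equivalent Q') : IsHyperbolic Q ↔ IsHyperbolic Q' :=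
  ⟨fun hQ => hQ.of_equivalent h, fun hQ => hQ.of_equivalent h.symm⟩

theorem IsAnisotropicPart.isHyperbolic {Q : QuadraticForm F V} {ψ : QuadraticForm F (Fin 0 → F)}
    (hψ : IsAnisotropicPart Q ψ) : IsHyperbolic Q := by
  obtain ⟨_, m, hm⟩ := hψ
  refine ⟨m, hm.trans ⟨{ toLinearEquiv := LinearEquiv.uniqueProd
                         map_app' := fun x => ?_ }⟩⟩
  change hyperbolicSpace F m x.2 = _
  rw [prod_apply, Subsingleton.elim x.1 0, QuadraticMap.map_zero, zero_add]

/-- The binary form `⟨a, -u²a⟩` is a hyperbolic plane. -/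
theorem prod_unaryForm_equivalent_hyperbolicPlane (h2 : (2 : F) ≠ 0)
    {ψ : QuadraticForm F (Fin 1 → F)} {c u : F} (hu : u ≠ 0) (ha : ψ 1 ≠ 0)
    (hc : c = -(u ^ 2 * ψ 1)) :
    (ψ.prod (unaryForm c)).Equivalent (weightedSumSquares F ![(1 : F), -1]) := by
  have hψ : ∀ x, ψ x = ψ 1 * x 0 ^ 2 := by
    intro x
    have : x = x 0 • (1 : Fin 1 → F) := by
      ext i
      rw [Subsingleton.elim i 0]
      simp
    conv_lhs => rw [this, QuadraticMap.map_smul, smul_eq_mul]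
    ring
  -- `a X² - u² a Y² = S² - T²` for `S + T = X + u Y` and `S - T = a (X - u Y)`
  let e : ((Fin 1 → F) × F) ≃ₗ[F] (Fin 2 → F) :=
    { toFun := fun x => ![(x.1 0 + u * x.2 + ψ 1 * (x.1 0 - u * x.2)) / 2,
        (x.1 0 + u * x.2 - ψ 1 * (x.1 0 - u * x.2)) / 2]
      map_add' := fun x y => by
        ext i; fin_cases i <;> simp <;> ring
      map_smul' := fun r x => by
        ext i; fin_cases i <;> simp <;> ring
      invFun := fun s => (fun _ => (s 0 + s 1 + (s 0 - s 1) / ψ 1) / 2,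
        (s 0 + s 1 - (s 0 - s 1) / ψ 1) / (2 * u))
      left_inv := fun x => by
        refine Prod.ext (funext fun i => ?_) ?_
        · rw [Subsingleton.elim i 0]
          simp only [Matrix.cons_val_zero, Matrix.cons_val_one]
          field_simp
          ring
        · simp only [Matrix.cons_val_zero, Matrix.cons_val_one]
          field_simp
          ring
      right_inv := fun s => by
        ext i
        fin_cases i
        · simp
          field_simp
          ring
        · simp
          field_simp
          ring }
  refine ⟨{ toLinearEquiv := e, map_app' := fun x => ?_ }⟩
  change weightedSumSquares F ![(1 : F), -1] ![(x.1 0 + u * x.2 + ψ 1 * (x.1 0 - u * x.2)) / 2,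
        (x.1 0 + u * x.2 - ψ 1 * (x.1 0 - u * x.2)) / 2] = _
  rw [prod_apply, hψ x.1, hc]
  simp [weightedSumSquares_apply, Fin.sum_univ_two, unaryForm]
  field_simp
  ring

theorem IsAnisotropicPart.le_four (O : Type*) [CommRing O] [IsDomain O]
    [IsDiscreteValuationRing O] [HenselianLocalRing O] [Finite (ResidueField O)] [Algebra O F]
    [IsFractionRing O F] (h2 : (2 : F) ≠ 0) {Q : QuadraticForm F V} {e : ℕ}
    {ψ : QuadraticForm F (Fin e → F)} (hψ : IsAnisotropicPart Q ψ) : e ≤ 4 := by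
  simpa using card_le_four_of_anisotropic O hψ.1 h2 (Pi.basisFun F (Fin e)).linearIndependent

/-- A dimension shared by all anisotropic parts is the dimension of the anisotropic part, since
a nondegenerate form has one. -/
theorem anisotropicPartHasDim_of_forall [Invertible (2 : F)] {n : ℕ} {Q : QuadraticForm F V}
    {b : Module.Basis (Fin n) F V} (hb : Q.discr b ≠ 0) {d : ℕ}
    (h : ∀ (e : ℕ) (ψ : QuadraticForm F (Fin e → F)), IsAnisotropicPart Q ψ → e = d) :
    AnisotropicPartHasDim Q d := by
  have : FiniteDimensional F V := b.finiteDimensional_of_finite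
  obtain ⟨e, ψ, hψ⟩ := exists_isAnisotropicPart (Invertible.ne_zero (2 : F)) Q
    (polar_nondegenerate_of_discr_ne_zero hb)
  obtain rfl := h e ψ hψ
  exact ⟨⟨ψ, hψ⟩, h⟩

/-- The dimension of an anisotropic part has the parity of that of the form, and the discriminants
agree up to squares and the sign `(-1) ^ m`. -/
theorem IsAnisotropicPart.exists_discr_eq [Invertible (2 : F)] {n e : ℕ} {Q : QuadraticForm F V}
    (b : Module.Basis (Fin n) F V) {ψ : QuadraticForm F (Fin e → F)} (hψ : IsAnisotropicPart Q ψ) :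
    ∃ m : ℕ, Q.Equivalent (ψ.prod (hyperbolicSpace F m)) ∧ n = e + 2 * m ∧ ∃ u : F, u ≠ 0 ∧
      Q.discr b = u ^ 2 * (ψ.discr (Pi.basisFun F (Fin e)) * (-1) ^ m) := by
  obtain ⟨_, m, hm⟩ := hψ
  refine ⟨m, hm, ?_, discr_eq_of_equivalent_prod_hyperbolicSpace b hm⟩
  have := hm.finrank_eq
  rwa [Module.finrank_prod, Module.finrank_fin_fun, finrank_hyperbolicSpace,
    Module.finrank_eq_card_basis b, Fintype.card_fin] at this

theorem isSquare_neg_one_pow_mul_iff {k m : ℕ} {c d u : F} (hu : u ≠ 0) (hkm : Even (k + m))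
    (h : c = u ^ 2 * (d * (-1) ^ m)) : IsSquare ((-1) ^ k * c) ↔ IsSquare d := by
  have h1 : (-1 : F) ^ k * c = u ^ 2 * d := by
    have h3 : (-1 : F) ^ k * (-1) ^ m = 1 := by rw [← pow_add, hkm.neg_one_pow]
    rw [h]
    linear_combination u ^ 2 * d * h3
  rw [h1]
  constructor
  · rintro ⟨s, hs⟩
    refine ⟨s / u, ?_⟩
    field_simp
    linear_combination hs
  · rintro ⟨s, hs⟩
    exact ⟨u * s, by rw [hs]; ring⟩

section

variable (O : Type*) [CommRing O] [IsDomain O] [IsDiscreteValuationRing O] [HenselianLocalRing O]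
  [Finite (ResidueField O)] [Algebra O F] [IsFractionRing O F] [Invertible (2 : F)]
  {n : ℕ} {Q : QuadraticForm F V} {b : Module.Basis (Fin n) F V}

theorem anisotropicPartHasDim_zero (hb : Q.discr b ≠ 0) (hQ : IsHyperbolic Q) :
    AnisotropicPartHasDim Q 0 :=
  anisotropicPartHasDim_of_forall hb fun _ _ hψ =>
    hψ.eq_zero_of_isHyperbolic (Invertible.ne_zero 2) hQ

include O in
theorem anisotropicPartHasDim_four (hb : Q.discr b ≠ 0) (hn : Even n) (hQ : ¬ IsHyperbolic Q)
    (hsq : IsSquare ((-1) ^ (n * (n - 1) / 2) * Q.discr b)) : AnisotropicPartHasDim Q 4 := by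
  refine anisotropicPartHasDim_of_forall hb fun e ψ hψ => ?_
  have h4 := hψ.le_four O (Invertible.ne_zero (2 : F))
  obtain ⟨m, hm, hdim, u, hu, hdisc⟩ := hψ.exists_discr_eq b
  have he : Even e := by
    rw [hdim, Nat.even_add] at hn
    exact hn.2 (even_two_mul m)
  obtain ⟨r, rfl⟩ := he
  have hr : r ≤ 2 := by omega
  interval_cases r
  · exact absurd hψ.isHyperbolic hQ
  · exfalso
    refine not_isSquare_neg_discr_of_anisotropic hψ.1 ?_
    have hexp : n * (n - 1) / 2 = (m + 1) * (2 * m + 1) := by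
      rw [show n = 2 * (m + 1) by omega, show 2 * (m + 1) - 1 = 2 * m + 1 by omega, mul_assoc,
        Nat.mul_div_cancel_left _ two_pos]
    rw [hexp] at hsq
    refine (isSquare_neg_one_pow_mul_iff (m := m + 1) hu ?_ ?_).1 hsq
    · exact ⟨(m + 1) * (m + 1), by ring⟩
    · rw [hdisc]; ring
  · rfl

include O in
theorem anisotropicPartHasDim_two (hb : Q.discr b ≠ 0) (hn : Even n) (hQ : ¬ IsHyperbolic Q)
    (hsq : ¬ IsSquare ((-1) ^ (n * (n - 1) / 2) * Q.discr b)) : AnisotropicPartHasDim Q 2 := by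
  refine anisotropicPartHasDim_of_forall hb fun e ψ hψ => ?_
  have h2 : (2 : F) ≠ 0 := Invertible.ne_zero (2 : F)
  have h4 := hψ.le_four O h2
  obtain ⟨m, hm, hdim, u, hu, hdisc⟩ := hψ.exists_discr_eq b
  have he : Even e := by
    rw [hdim, Nat.even_add] at hn
    exact hn.2 (even_two_mul m)
  obtain ⟨r, rfl⟩ := he
  have hr : r ≤ 2 := by omega
  interval_cases r
  · exact absurd hψ.isHyperbolic hQ
  · rfl
  · exfalso
    apply hsq
    have hexp : n * (n - 1) / 2 = (m + 2) * (2 * m + 3) := by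
      rw [show n = 2 * (m + 2) by omega, show 2 * (m + 2) - 1 = 2 * m + 3 by omega, mul_assoc,
        Nat.mul_div_cancel_left _ two_pos]
    rw [hexp]
    refine (isSquare_neg_one_pow_mul_iff (m := m) hu ?_ hdisc).2 ?_
    · exact ⟨m ^ 2 + 4 * m + 3, by ring⟩
    · obtain ⟨s, hs⟩ := isSquare_det_polarGram_of_anisotropic O hψ.1 h2
        (Pi.basisFun F (Fin (2 + 2)))
      rw [det_polarGram_basis, Fintype.card_fin] at hs
      refine ⟨s / 4, ?_⟩
      have h40 : (4 : F) ≠ 0 := by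
        rw [show (4 : F) = 2 * 2 by norm_num]
        exact mul_ne_zero h2 h2
      field_simp
      linear_combination hs

theorem anisotropicPartHasDim_one (hb : Q.discr b ≠ 0) (hn : Odd n) {c : F}
    (hQ : IsHyperbolic (Q.prod (unaryForm c))) : AnisotropicPartHasDim Q 1 := by
  refine anisotropicPartHasDim_of_forall hb fun e ψ hψ => ?_
  have h1 := hψ.le_one_of_isHyperbolic_prod (Invertible.ne_zero 2) hQ
  obtain ⟨m, hm, hdim, -⟩ := hψ.exists_discr_eq b
  obtain ⟨r, hr⟩ := hn
  omega

include O in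
theorem anisotropicPartHasDim_three (hb : Q.discr b ≠ 0) (hn : Odd n)
    (hQ : ¬ IsHyperbolic (Q.prod (unaryForm ((-1) ^ (n * (n + 1) / 2) * Q.discr b)))) :
    AnisotropicPartHasDim Q 3 := by
  refine anisotropicPartHasDim_of_forall hb fun e ψ hψ => ?_
  have h2 : (2 : F) ≠ 0 := Invertible.ne_zero (2 : F)
  have h4 := hψ.le_four O h2
  obtain ⟨m, hm, hdim, u, hu, hdisc⟩ := hψ.exists_discr_eq b
  obtain ⟨r, hr⟩ := hn
  have he : e = 1 ∨ e = 3 := by omega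
  rcases he with rfl | rfl
  · exfalso
    apply hQ
    have hψ1 : ψ.discr (Pi.basisFun F (Fin 1)) = ψ 1 := by
      have h := det_polarGram_basis ψ (Pi.basisFun F (Fin 1))
      rw [Matrix.det_fin_one, Fintype.card_fin, pow_one] at h
      simp only [polarGram, Matrix.of_apply, polar_self, two_smul, ← two_mul] at h
      rw [← mul_left_cancel₀ h2 h]
      congr 1
      ext i
      rw [Subsingleton.elim i 0]
      simp
    have hexp : n * (n + 1) / 2 = (2 * m + 1) * (m + 1) := by
      rw [show n = 2 * m + 1 by omega, show 2 * m + 1 + 1 = 2 * (m + 1) by ring, mul_left_comm,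
        Nat.mul_div_cancel_left _ two_pos]
    have hc : (-1) ^ (n * (n + 1) / 2) * Q.discr b = -(u ^ 2 * ψ 1) := by
      rw [hexp, hdisc, hψ1]
      have h3 : (-1 : F) ^ ((2 * m + 1) * (m + 1)) * (-1) ^ m = -1 := by
        rw [← pow_add]
        exact Odd.neg_one_pow ⟨m ^ 2 + 2 * m, by ring⟩
      linear_combination u ^ 2 * ψ 1 * h3
    have ha : ψ 1 ≠ 0 := by
      rw [← hψ1]
      intro h0
      exact hb (by rw [hdisc, h0]; ring)
    have hplane := prod_unaryForm_equivalent_hyperbolicPlane h2 hu ha hc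
    refine ⟨m + 1, (Equivalent.prod hm (Equivalent.refl _)).trans (Equivalent.trans ?_
      (hyperbolicSpace_succ_equivalent m))⟩
    refine Equivalent.trans ?_ (Equivalent.prod (Equivalent.refl (hyperbolicSpace F m)) hplane)
    refine Equivalent.trans (Equivalent.prod ⟨IsometryEquiv.prodComm _ _⟩ (Equivalent.refl _)) ?_
    exact prod_assoc_equivalent _ _ _
  · rfl

end

end LocalField

/-! ### The completion of a number field at a finite prime -/

section Completion

open IsLocalRing HeightOneSpectrum

variable {K : Type*} [Field K] [NumberField K] (𝔭 : HeightOneSpectrum (𝓞 K))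

theorem mem_maximalIdeal_iff_valued_lt_one (x : 𝔭.adicCompletionIntegers K) :
    x ∈ maximalIdeal (𝔭.adicCompletionIntegers K) ↔ Valued.v (x : 𝔭.adicCompletion K) < 1 := by
  rw [mem_maximalIdeal, mem_nonunits_iff, adicCompletionIntegers.isUnit_iff_valued_eq_one]
  have : Valued.v (x : 𝔭.adicCompletion K) ≤ 1 := x.2
  exact ⟨fun h => lt_of_le_of_ne this h, fun h => h.ne⟩

theorem residue_algebraMap_surjective :
    Function.Surjective fun r : 𝓞 K =>
      residue (𝔭.adicCompletionIntegers K) (algebraMap (𝓞 K) (𝔭.adicCompletionIntegers K) r) := by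
  intro z
  obtain ⟨x, rfl⟩ := residue_surjective z
  obtain ⟨k, hk⟩ : ∃ k : K, Valued.v (algebraMap K (𝔭.adicCompletion K) k - x) < 1 := by
    have hmem : {y : 𝔭.adicCompletion K | Valued.v (y - x) < 1} ∈
        nhds (x : 𝔭.adicCompletion K) := by
      refine Valued.mem_nhds.2 ⟨1, fun y hy => ?_⟩
      simpa [Valuation.restrict_lt_one_iff] using hy
    obtain ⟨_, hy, k, rfl⟩ := mem_closure_iff_nhds.1 (denseRange_algebraMap K 𝔭 x) _ hmem
    exact ⟨k, hy⟩
  have hk1 : 𝔭.valuation K k ≤ 1 := by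
    rw [← valuedAdicCompletion_eq_valuation' 𝔭 k]
    change Valued.v (algebraMap K (𝔭.adicCompletion K) k) ≤ 1
    have h := Valuation.map_add Valued.v (algebraMap K (𝔭.adicCompletion K) k - x) x
    rw [sub_add_cancel] at h
    exact h.trans (max_le hk.le x.2)
  obtain ⟨r, hr⟩ := exists_valuation_sub_lt_of_integer 𝔭 hk1 1
  refine ⟨r, ?_⟩
  rw [← sub_eq_zero]
  change residue _ _ - residue _ _ = 0
  rw [← map_sub, residue_eq_zero_iff, mem_maximalIdeal_iff_valued_lt_one]
  change Valued.v (algebraMap K (𝔭.adicCompletion K) (algebraMap (𝓞 K) K r) - x) < 1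
  have h : Valued.v (algebraMap K (𝔭.adicCompletion K) (algebraMap (𝓞 K) K r - k)) < 1 := by
    rw [Units.val_one, ← valuedAdicCompletion_eq_valuation' 𝔭] at hr
    exact hr
  rw [map_sub] at h
  have h3 := Valuation.map_add Valued.v (algebraMap K (𝔭.adicCompletion K) (algebraMap (𝓞 K) K r) -
    algebraMap K (𝔭.adicCompletion K) k) (algebraMap K (𝔭.adicCompletion K) k - x)
  rw [sub_add_sub_cancel] at h3
  exact h3.trans_lt (max_lt h hk)

instance finite_residueField_adicCompletionIntegers :
    Finite (ResidueField (𝔭.adicCompletionIntegers K)) := by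
  let f : 𝓞 K →+* ResidueField (𝔭.adicCompletionIntegers K) :=
    (residue _).comp (algebraMap (𝓞 K) (𝔭.adicCompletionIntegers K))
  have hf : ∀ r ∈ 𝔭.asIdeal, f r = 0 := by
    intro r hr
    change residue _ _ = 0
    rw [residue_eq_zero_iff, mem_maximalIdeal_iff_valued_lt_one]
    change Valued.v (algebraMap K (𝔭.adicCompletion K) (algebraMap (𝓞 K) K r)) < 1
    have := (𝔭.valuation_lt_one_iff_mem (K := K) r).2 hr
    rwa [← valuedAdicCompletion_eq_valuation' 𝔭] at this
  have : Finite (𝓞 K ⧸ 𝔭.asIdeal) := 𝔭.asIdeal.finiteQuotientOfFreeOfNeBot 𝔭.ne_bot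
  exact Finite.of_surjective (Ideal.Quotient.lift 𝔭.asIdeal f hf)
    (Ideal.Quotient.lift_surjective_of_surjective _ hf (residue_algebraMap_surjective 𝔭))

instance compactSpace_adicCompletionIntegers : CompactSpace (𝔭.adicCompletionIntegers K) := by
  have h : CompactSpace (Valued.integer (𝔭.adicCompletion K)) := by
    rw [Valued.integer.compactSpace_iff_completeSpace_and_isDiscreteValuationRing_and_finite_residueField]
    exact ⟨(Valued.isClosed_integer (𝔭.adicCompletion K)).completeSpace_coe,
      inferInstanceAs (IsDiscreteValuationRing (𝔭.adicCompletionIntegers K)),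
      finite_residueField_adicCompletionIntegers 𝔭⟩
  exact h

open scoped Pointwise in
instance isAdicComplete_adicCompletionIntegers :
    IsAdicComplete (maximalIdeal (𝔭.adicCompletionIntegers K)) (𝔭.adicCompletionIntegers K) where
  prec' f hf := by
    -- the cosets `f n + 𝔪 ^ n` are compact and nested
    let S n : Set (𝔭.adicCompletionIntegers K) :=
      f n +ᵥ ((maximalIdeal (𝔭.adicCompletionIntegers K) ^ n : Ideal _) : Set _)
    have hS n : S (n + 1) ⊆ S n := by
      apply (Set.vadd_set_subset_vadd_set_iff.mpr (Ideal.pow_le_pow_right n.le_succ)).trans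
      simpa [S] using (hf n.le_succ).symm
    have h n : IsClosed (S n) := (IsNoetherianRing.isClosed_ideal (maximalIdeal _ ^ n)).vadd (f n)
    obtain ⟨L, hL⟩ := (h 0).isCompact.nonempty_iInter_of_sequence_nonempty_isCompact_isClosed S hS
      (by simp [S]) h
    refine ⟨L, fun n => ?_⟩
    obtain ⟨y, hy, rfl⟩ := Set.mem_iInter.mp hL n
    simpa [SModEq.sub_mem] using hy

instance henselianLocalRing_adicCompletionIntegers :
    HenselianLocalRing (𝔭.adicCompletionIntegers K) where
  is_henselian f hf a₀ h₁ h₂ :=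
    HenselianRing.is_henselian (I := maximalIdeal _) f hf a₀ h₁ (h₂.map _)

end Completion

/-! ### Localization of forms over a number field -/

section Localization

open QuadraticMap TensorProduct

variable {K : Type*} [Field K] [NumberField K] (𝔭 : HeightOneSpectrum (𝓞 K))
  {V W : Type*} [AddCommGroup V] [Module K V] [AddCommGroup W] [Module K W]

instance charZero_adicCompletion : CharZero (𝔭.adicCompletion K) :=
  charZero_of_injective_algebraMap (algebraMap K (𝔭.adicCompletion K)).injective

theorem localForm_tmul (φ : QuadraticForm K V) (x : V) :
    localForm 𝔭 φ (1 ⊗ₜ x) = algebraMap K (𝔭.adicCompletion K) (φ x) := by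
  rw [localForm, QuadraticForm.baseChange_tmul, one_mul, Algebra.algebraMap_eq_smul_one]

theorem localForm_equivalent {φ : QuadraticForm K V} {φ' : QuadraticForm K W}
    (h : φ.Equivalent φ') : (localForm 𝔭 φ).Equivalent (localForm 𝔭 φ') := by
  obtain ⟨f⟩ := h
  have hcomp : (localForm 𝔭 φ').comp
      (f.toLinearEquiv.toLinearMap.baseChange (𝔭.adicCompletion K)) = localForm 𝔭 φ := by
    apply baseChange_ext
    intro x
    rw [QuadraticMap.comp_apply, LinearMap.baseChange_tmul, localForm_tmul, localForm_tmul]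
    exact congrArg _ (f.map_app x)
  exact ⟨{ toLinearEquiv := f.toLinearEquiv.baseChange K (𝔭.adicCompletion K) V W
           map_app' := fun x => congrArg (fun Q => Q x) hcomp }⟩

theorem localForm_prod_unaryForm_equivalent (φ : QuadraticForm K V) (c : K) :
    (localForm 𝔭 (φ.prod (unaryForm c))).Equivalent
      ((localForm 𝔭 φ).prod (unaryForm (algebraMap K (𝔭.adicCompletion K) c))) := by
  let e : (𝔭.adicCompletion K ⊗[K] (V × K)) ≃ₗ[𝔭.adicCompletion K]
      (𝔭.adicCompletion K ⊗[K] V) × 𝔭.adicCompletion K :=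
    (TensorProduct.prodRight K (𝔭.adicCompletion K) (𝔭.adicCompletion K) V K).trans
      ((LinearEquiv.refl _ _).prodCongr
        (AlgebraTensorModule.rid K (𝔭.adicCompletion K) (𝔭.adicCompletion K)))
  have hcomp : ((localForm 𝔭 φ).prod (unaryForm (algebraMap K (𝔭.adicCompletion K) c))).comp
      e.toLinearMap = localForm 𝔭 (φ.prod (unaryForm c)) := by
    apply baseChange_ext
    intro x
    have he : e (1 ⊗ₜ x) = (1 ⊗ₜ x.1, algebraMap K (𝔭.adicCompletion K) x.2) := by
      simp [e, Algebra.algebraMap_eq_smul_one]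
    change (localForm 𝔭 φ).prod _ (e (1 ⊗ₜ x)) = _
    rw [he, prod_apply, localForm_tmul, localForm_tmul, prod_apply, map_add]
    simp [unaryForm, Algebra.smul_def]
  exact ⟨{ toLinearEquiv := e, map_app' := fun x => congrArg (fun Q => Q x) hcomp }⟩

theorem discr_localForm [Invertible (2 : 𝔭.adicCompletion K)] {n : ℕ} (φ : QuadraticForm K V)
    (b : Module.Basis (Fin n) K V) :
    (localForm 𝔭 φ).discr (b.baseChange (𝔭.adicCompletion K)) =
      algebraMap K (𝔭.adicCompletion K) (φ.discr b) := by
  rw [QuadraticForm.discr, QuadraticForm.discr, RingHom.map_det]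
  congr 1
  ext i j
  rw [RingHom.mapMatrix_apply, Matrix.map_apply, toMatrix_apply_eq, toMatrix_apply_eq,
    Module.Basis.baseChange_apply, Module.Basis.baseChange_apply, polar, ← tmul_add,
    localForm_tmul, localForm_tmul, localForm_tmul, polar, map_mul, map_sub, map_sub]
  congr 1
  rw [invOf_eq_inv, invOf_eq_inv, map_inv₀, map_ofNat]

theorem discr_ne_zero_of_nondegenerate {n : ℕ} {φ : QuadraticForm K V} (hφ : φ.Nondegenerate)
    (b : Module.Basis (Fin n) K V) : φ.discr b ≠ 0 :=
  (LinearMap.separatingLeft_iff_det_ne_zero b).1 (nondegenerate_associated_iff.2 hφ).1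

omit [NumberField K] in
theorem diagForm_append_equivalent (a : List (𝓞 K)) (c : 𝓞 K) :
    (diagForm (a ++ [c])).Equivalent ((diagForm a).prod (unaryForm (algebraMap (𝓞 K) K c))) := by
  let ε : Fin (a.length + 1) ≃ Fin (a ++ [c]).length := finCongr (by simp)
  let e : ((Fin a.length → K) × K) ≃ₗ[K] (Fin (a.length + 1) → K) :=
    { toFun := fun x => Fin.snoc x.1 x.2
      map_add' := fun x y => by
        ext i; refine Fin.lastCases ?_ (fun j => ?_) i <;> simp
      map_smul' := fun r x => by
        ext i; refine Fin.lastCases ?_ (fun j => ?_) i <;> simp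
      invFun := fun y => (Fin.init y, y (Fin.last _))
      left_inv := fun x => by simp
      right_inv := fun y => by simp }
  refine Equivalent.symm ⟨{ toLinearEquiv := e.trans (LinearEquiv.funCongrLeft K K ε.symm)
                            map_app' := fun x => ?_ }⟩
  change diagForm (a ++ [c]) (fun i => (Fin.snoc x.1 x.2 : Fin (a.length + 1) → K) (ε.symm i)) = _
  rw [diagForm, weightedSumSquares_apply, ← ε.sum_comp, Fin.sum_univ_castSucc, prod_apply, diagForm,
    weightedSumSquares_apply]
  simp [ε, unaryForm, Algebra.smul_def]

/-- The dimension of the anisotropic part of `φ ⊗ K_𝔭`, in terms of the discriminant with respect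
to a given basis over `K`. -/
theorem anisotropicPartHasDim_localForm {n : ℕ} (b : Module.Basis (Fin n) K V) (φ : QuadraticForm K V)
    (hb : φ.discr b ≠ 0) :
    (Even n →
      (IsHyperbolic (localForm 𝔭 φ) → AnisotropicPartHasDim (localForm 𝔭 φ) 0) ∧
      (¬ IsHyperbolic (localForm 𝔭 φ) → IsLocalSquare 𝔭 ((-1) ^ (n * (n - 1) / 2) * φ.discr b) →
        AnisotropicPartHasDim (localForm 𝔭 φ) 4) ∧
      (¬ IsHyperbolic (localForm 𝔭 φ) → ¬ IsLocalSquare 𝔭 ((-1) ^ (n * (n - 1) / 2) * φ.discr b) →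
        AnisotropicPartHasDim (localForm 𝔭 φ) 2)) ∧
    (Odd n →
      (IsHyperbolic (localForm 𝔭
          (φ.prod (unaryForm ((-1) ^ (n * (n + 1) / 2) * φ.discr b)))) →
        AnisotropicPartHasDim (localForm 𝔭 φ) 1) ∧
      (¬ IsHyperbolic (localForm 𝔭
          (φ.prod (unaryForm ((-1) ^ (n * (n + 1) / 2) * φ.discr b)))) →
        AnisotropicPartHasDim (localForm 𝔭 φ) 3)) := by
  let _ : Invertible (2 : 𝔭.adicCompletion K) := invertibleOfNonzero two_ne_zero
  have hdisc := discr_localForm 𝔭 φ b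
  have hb' : (localForm 𝔭 φ).discr (b.baseChange (𝔭.adicCompletion K)) ≠ 0 := by
    rw [hdisc]
    exact (map_ne_zero _).2 hb
  have hmap : ∀ k, algebraMap K (𝔭.adicCompletion K) ((-1) ^ k * φ.discr b) =
      (-1) ^ k * (localForm 𝔭 φ).discr (b.baseChange (𝔭.adicCompletion K)) := by
    intro k
    rw [hdisc]
    simp
  refine ⟨fun hn => ⟨fun h => anisotropicPartHasDim_zero hb' h, fun h hsq => ?_, fun h hsq => ?_⟩,
    fun hn => ⟨fun h => ?_, fun h => ?_⟩⟩
  · rw [IsLocalSquare, hmap] at hsq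
    exact anisotropicPartHasDim_four (𝔭.adicCompletionIntegers K) hb' hn h hsq
  · rw [IsLocalSquare, hmap] at hsq
    exact anisotropicPartHasDim_two (𝔭.adicCompletionIntegers K) hb' hn h hsq
  · exact anisotropicPartHasDim_one hb' hn
      (h.of_equivalent (localForm_prod_unaryForm_equivalent 𝔭 φ _))
  · rw [isHyperbolic_congr (localForm_prod_unaryForm_equivalent 𝔭 φ _), hmap] at h
    exact anisotropicPartHasDim_three (𝔭.adicCompletionIntegers K) hb' hn h

end Localization

theorem mainTheorem7 {K : Type*} [Field K] [NumberField K]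
    (𝔭 : HeightOneSpectrum (𝓞 K)) {V : Type*} [AddCommGroup V] [Module K V] {n : ℕ}
    (b : Module.Basis (Fin n) K V) (φ : QuadraticForm K V) (hφ : φ.Nondegenerate) :
    (Even n →
      (IsHyperbolic (localForm 𝔭 φ) → AnisotropicPartHasDim (localForm 𝔭 φ) 0) ∧
      (¬ IsHyperbolic (localForm 𝔭 φ) → IsLocalSquare 𝔭 ((-1) ^ (n * (n - 1) / 2) * φ.discr b) →
        AnisotropicPartHasDim (localForm 𝔭 φ) 4) ∧
      (¬ IsHyperbolic (localForm 𝔭 φ) → ¬ IsLocalSquare 𝔭 ((-1) ^ (n * (n - 1) / 2) * φ.discr b) →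
        AnisotropicPartHasDim (localForm 𝔭 φ) 2)) ∧
    (Odd n →
      (IsHyperbolic (localForm 𝔭
          (φ.prod (unaryForm ((-1) ^ (n * (n + 1) / 2) * φ.discr b)))) →
        AnisotropicPartHasDim (localForm 𝔭 φ) 1) ∧
      (¬ IsHyperbolic (localForm 𝔭
          (φ.prod (unaryForm ((-1) ^ (n * (n + 1) / 2) * φ.discr b)))) →
        AnisotropicPartHasDim (localForm 𝔭 φ) 3)) ∧
    (∀ a : List (𝓞 K), φ.Equivalent (diagForm a) →
      AnisotropicPartHasDim (localForm 𝔭 φ) (anisotropicPartLocalDim 𝔭 a)) := by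
  have hb := discr_ne_zero_of_nondegenerate hφ b
  obtain ⟨heven, hodd⟩ := anisotropicPartHasDim_localForm 𝔭 b φ hb
  refine ⟨heven, hodd, fun a ha => ?_⟩
  refine AnisotropicPartHasDim.of_equivalent (localForm_equivalent 𝔭 ha).symm ?_
  -- in the standard basis the determinant of `⟨a₁, …, aₙ⟩` is `a₁ ⋯ aₙ` on the nose
  have hdiscr : (diagForm a).discr (Pi.basisFun K (Fin a.length)) =
      algebraMap (𝓞 K) K a.prod := by
    rw [diagForm, discr_weightedSumSquares, ← map_prod]
    congr 1
    rw [← List.prod_ofFn, List.ofFn_get]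
  have ha0 : (diagForm a).discr (Pi.basisFun K (Fin a.length)) ≠ 0 := by
    obtain ⟨u, hu, h⟩ := discr_eq_of_equivalent ha b (Pi.basisFun K (Fin a.length))
    intro h0
    exact hb (by rw [h, h0, mul_zero])
  obtain ⟨heven, hodd⟩ := anisotropicPartHasDim_localForm 𝔭 _ _ ha0
  have hsign : ∀ k, (-1 : K) ^ k * (diagForm a).discr (Pi.basisFun K (Fin a.length)) =
      algebraMap (𝓞 K) K ((-1) ^ k * a.prod) := by
    intro k
    rw [hdiscr]
    simp
  simp only [hsign] at heven hodd
  simp only [anisotropicPartLocalDim]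
  split_ifs with hn hhyp hsq hhyp
  · exact (heven hn).1 hhyp
  · exact (heven hn).2.1 hhyp hsq
  · exact (heven hn).2.2 hhyp hsq
  · exact (hodd (Nat.not_even_iff_odd.1 hn)).1
      (hhyp.of_equivalent (localForm_equivalent 𝔭 (diagForm_append_equivalent a _)))
  · refine (hodd (Nat.not_even_iff_odd.1 hn)).2 fun h => hhyp ?_
    exact h.of_equivalent (localForm_equivalent 𝔭 (diagForm_append_equivalent a _).symm)
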